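/- For $t\ge 0$ let $h(t)=-\sum_{x\in\mathbb Z}\mathbb P(W_t=x)\log \mathbb P(W_t=x)$ be the Shannon entropy (natural logarithm) of the continuous-time rate-1 simple random walk $W$ on $\mathbb Z$ started at $0$ (the walk jumps at rate $1$, each jump being $\pm1$ with probability $\tfrac12$ each). Let $d=d_i$ and $N=N_i$ be natural numbers indexed by a set equipped with a filter (for example sequences indexed by $i\in\mathbb N$, with $i\to\infty$); all asymptotic notation refers to this limit, so that $a\ll b$ means $a=o(b)$, and $a\asymp b$ means $a=O(b)$ and $b=O(a)$. Assume that $d\to\infty$ and $d=O(N)$. For each index let $X$ and $Y$ be independent random vectors in $\mathbb Z^d$, both with the multinomial distribution with $N$ trials and uniform parameter $\tfrac1d(1,\dots,1)$, and let $H(X-Y)$ be the Shannon entropy of $X-Y$. Then: (i) if $d\ll N$, then $$\Bigl|H(X-Y)-d\cdot h\!\left(\tfrac{2N}{d}\right)\Bigr| = O\!\left(\max\bigl\{dN^{-1/3},\ d\,(N/d)^{-1/4},\ \log N\bigr\}\right);$$ (ii) if $d\asymp N$, then $$\Bigl|H(X-Y)-d\cdot h\!\left(\tfrac{2N}{d}\right)\Bigr|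 = O\!\left(N^{2/3}\right).$$ -/

import Mathlib

open MeasureTheory ProbabilityTheory Filter Asymptotics
open scoped NNReal ENNReal

noncomputable section

/-- The multinomial distribution on `ℤ ^ d` with `m` trials and parameter `p`: each vector `k` of
natural numbers with `∑ i, k i = m` has mass `m! / ∏ i, (k i)! * ∏ i, p i ^ k i`. -/
def multinomialLaw {d : ℕ} (m : ℕ) (p : Fin d → ℝ) : Measure (Fin d → ℤ) :=
  ∑ k ∈ Finset.piAntidiag (Finset.univ : Finset (Fin d)) m,
    ENNReal.ofReal ((Nat.multinomial Finset.univ k : ℝ) * ∏ i, p i ^ k i) •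
      Measure.dirac (fun i => (k i : ℤ))

/-- The multinomial distribution is a probability measure when `p` is a probability vector. -/
theorem isProbabilityMeasure_multinomialLaw {d : ℕ} (m : ℕ) (p : Fin d → ℝ)
    (hp : ∀ i, 0 ≤ p i) (hp1 : ∑ i, p i = 1) : IsProbabilityMeasure (multinomialLaw m p) := by
  refine ⟨?_⟩
  have h := Finset.sum_pow_eq_sum_piAntidiag (Finset.univ : Finset (Fin d)) p m
  simp only [multinomialLaw, Measure.coe_finsetSum, Finset.sum_apply, Measure.smul_apply,
    measure_univ, smul_eq_mul, mul_one]
  rw [← ENNReal.ofReal_sum_of_nonneg fun k _ =>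
    mul_nonneg (Nat.cast_nonneg _) (Finset.prod_nonneg fun i _ => pow_nonneg (hp i) _), ← h, hp1]
  simp

/-- The Shannon entropy (in nats) `- ∑ x, μ {x} * log (μ {x})` of a distribution `μ` on a
countable set, with the convention `0 * log 0 = 0`. -/
def shannonEntropy {α : Type*} [MeasurableSpace α] (μ : Measure α) : ℝ :=
  ∑' x, Real.negMulLog (μ.real {x})

/-- The uniform distribution on `{1, -1}`. -/
def signLaw : Measure ℤ :=
  (2⁻¹ : ℝ≥0∞) • Measure.dirac 1 + (2⁻¹ : ℝ≥0∞) • Measure.dirac (-1)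

/-- The law of the position after `n` steps of the discrete-time simple random walk on `ℤ`
started at `0`, that is, of a sum of `n` independent uniform signs. -/
def discreteWalkLaw : ℕ → Measure ℤ
  | 0 => Measure.dirac 0
  | n + 1 => (discreteWalkLaw n).conv signLaw

/-- The law at time `t` of the continuous-time rate-1 simple random walk on `ℤ` started at `0`:
the number of jumps up to time `t` is Poisson with mean `t`, and the jumps are independent
uniform signs, independent of the number of jumps. -/
def walkLaw (t : ℝ≥0) : Measure ℤ :=
  (poissonMeasure t).bind discreteWalkLaw

/-- The entropy `h(t)` at time `t` of the rate-1 simple random walk on `ℤ`. -/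
def walkEntropy (t : ℝ≥0) : ℝ :=
  shannonEntropy (walkLaw t)

instance isProbabilityMeasure_signLaw : IsProbabilityMeasure signLaw :=
  ⟨by simp [signLaw, ENNReal.inv_two_add_inv_two]⟩

instance isProbabilityMeasure_discreteWalkLaw (n : ℕ) :
    IsProbabilityMeasure (discreteWalkLaw n) := by
  induction n with
  | zero => unfold discreteWalkLaw; infer_instance
  | succ n ih => unfold discreteWalkLaw; infer_instance

instance isProbabilityMeasure_walkLaw (t : ℝ≥0) : IsProbabilityMeasure (walkLaw t) := by
  refine ⟨?_⟩
  rw [walkLaw, Measure.bind_apply MeasurableSet.univ measurable_from_nat.aemeasurable]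
  simp

theorem lintegral_abs_discreteWalkLaw_le (n : ℕ) :
    ∫⁻ x, (x.natAbs : ℝ≥0∞) ∂(discreteWalkLaw n) ≤ n := by
  induction n with
  | zero => simp [discreteWalkLaw]
  | succ n ih =>
    rw [discreteWalkLaw, Measure.lintegral_conv .of_discrete]
    calc ∫⁻ x, ∫⁻ y, ((x + y).natAbs : ℝ≥0∞) ∂signLaw ∂(discreteWalkLaw n)
        ≤ ∫⁻ x, ((x.natAbs : ℝ≥0∞) + 1) ∂(discreteWalkLaw n) := by
          refine lintegral_mono fun x => ?_
          have h1 : (((x + 1).natAbs : ℕ) : ℝ≥0∞) ≤ (x.natAbs : ℝ≥0∞) + 1 := by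
            exact_mod_cast (by omega : (x + 1).natAbs ≤ x.natAbs + 1)
          have h2 : (((x + -1).natAbs : ℕ) : ℝ≥0∞) ≤ (x.natAbs : ℝ≥0∞) + 1 := by
            exact_mod_cast (by omega : (x + -1).natAbs ≤ x.natAbs + 1)
          rw [signLaw, lintegral_add_measure, lintegral_smul_measure, lintegral_smul_measure,
            lintegral_dirac, lintegral_dirac]
          calc _ ≤ (2⁻¹ : ℝ≥0∞) • ((x.natAbs : ℝ≥0∞) + 1)
                + (2⁻¹ : ℝ≥0∞) • ((x.natAbs : ℝ≥0∞) + 1) := by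
                simp only [smul_eq_mul]; gcongr
            _ = _ := by
                rw [← add_smul, ENNReal.inv_two_add_inv_two, one_smul]
      _ ≤ ((n + 1 : ℕ) : ℝ≥0∞) := by
          rw [lintegral_add_right _ measurable_const]
          simp only [lintegral_const, measure_univ, mul_one]
          push_cast
          gcongr

theorem lintegral_abs_walkLaw_lt_top (t : ℝ≥0) :
    ∫⁻ x, (x.natAbs : ℝ≥0∞) ∂(walkLaw t) < ∞ := by
  rw [walkLaw, Measure.lintegral_bind measurable_from_nat.aemeasurable
    Measurable.of_discrete.aemeasurable]
  refine (lintegral_mono lintegral_abs_discreteWalkLaw_le).trans_lt ?_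
  have hi : Integrable (fun n : ℕ => (n : ℝ)) (poissonMeasure t) := by
    rw [integrable_poissonMeasure_iff]
    have hs := ((Real.summable_pow_div_factorial (t : ℝ)).mul_left (t : ℝ)).mul_left
      (Real.exp (-t))
    refine (summable_nat_add_iff 1).mp (hs.congr fun n => ?_)
    rw [Nat.factorial_succ]
    have : (n.factorial : ℝ) ≠ 0 := by positivity
    have h' : ((n : ℝ) + 1) ≠ 0 := by positivity
    push_cast
    rw [Real.norm_of_nonneg (by positivity)]
    field_simp
    ring
  have := hi.lintegral_lt_top
  simpa using this

/-- The entropy of the rate-1 simple random walk is finite at every time. -/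
theorem summable_walkEntropy (t : ℝ≥0) :
    Summable fun x : ℤ => Real.negMulLog ((walkLaw t).real {x}) := by
  have h2 : Summable fun x : ℤ => (walkLaw t).real {x} * (x.natAbs : ℝ) := by
    have h := lintegral_abs_walkLaw_lt_top t
    rw [lintegral_countable'] at h
    refine (ENNReal.summable_toReal h.ne).congr fun x => ?_
    rw [ENNReal.toReal_mul, ENNReal.toReal_natCast, measureReal_def, mul_comm]
  have h3 : Summable fun x : ℤ => Real.exp (-(x.natAbs : ℝ)) := by
    have h : Summable fun n : ℕ => Real.exp (-(n : ℝ)) := Real.summable_exp_neg_nat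
    exact Summable.of_nat_of_neg (by simpa using h) (by simpa using h)
  refine Summable.of_nonneg_of_le (fun x => Real.negMulLog_nonneg measureReal_nonneg
    measureReal_le_one) (fun x => ?_) (h2.add h3)
  set p := (walkLaw t).real {x}
  set a := (x.natAbs : ℝ)
  have hp : 0 ≤ p := measureReal_nonneg
  rcases hp.eq_or_lt with h | h
  · rw [← h]; simp [Real.exp_nonneg]
  · have := Real.add_one_le_exp (-a - Real.log p)
    have e : p * Real.exp (-a - Real.log p) = Real.exp (-a) := by
      rw [Real.exp_sub, Real.exp_log h]; field_simp
    rw [Real.negMulLog]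
    nlinarith [mul_le_mul_of_nonneg_left this hp]

end

/-!
The error is in fact only logarithmic in `N`, which both bounds allow.

Put `r = N / d`. A uniform multinomial vector is a vector of `d` independent Poisson variables of
mean `r` conditioned on their sum being `N`, and the difference of two independent Poisson
variables of mean `r` is the walk at time `2 * r` (`walkLaw_two_mul`); let `q` be its law. Summing
over pairs, the law `ν` of `X - Y` satisfies `ν ≤ Q / c ^ 2` pointwise, where `Q` is the law of `d`
independent copies of the walk and `c`, of order `N ^ (-1 / 2)`, is the probability that a Poisson
variable of mean `N` equals `N` (`multinomialDiffMass_mul_le`). With Gibbs' inequality this shows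
that the entropy of `ν` is the cross-entropy `-∑ ν log Q` up to `2 log (1 / c) = O(log N)`
(`multinomialDiffEntropy_le`, `le_multinomialDiffEntropy`). The cross-entropy is `d` times
`E[-log q(U - V)]` for independent binomial variables `U`, `V` with `N` trials and mean `r`. The
entropy of the walk is the same expression with Poisson variables, so that only these two
expectations have to be compared.

* Upper bound (`binomialCrossEntropy_le`): `q` is log-concave, as an autocorrelation of a
  log-concave sequence, so `-log q` is convex; and a binomial variable is dominated in the convex
  order by a Poisson variable of the same mean. Hence the entropy of `ν` never exceeds that of the
  `d` walks.
* Lower bound (`walkEntropy_sub_binomialCrossEntropy_le`): the binomial mass at `k` is at least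
  `1 - (k - r) ^ 2 / (N - r)` times the Poisson mass (`poissonMass_mul_le_binomialMass`). As
  `-log q ≥ 0`, the loss is at most the expectation of this relative error times `-log q`. Since
  `q (i - j)` is at least the product of the Poisson masses of `i` and `j`, `-log q` grows at most
  quadratically on the scale `√r`, and the central moments of order two and four of the Poisson
  distribution bound the loss by `O((1 + log N) / d)` per coordinate.
-/

/-! ### Poisson and binomial distributions: moments, convex order and pointwise bounds -/

/-- The mass `exp (-r) * r ^ n / n!` that the Poisson distribution of mean `r` gives to `n`. -/
noncomputable def poissonMass (r : ℝ≥0) (n : ℕ) : ℝ := Real.exp (-r) * (r : ℝ) ^ n / n.factorial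

lemma poissonMeasure_real_singleton_eq (r : ℝ≥0) (n : ℕ) :
    (poissonMeasure r).real {n} = poissonMass r n := poissonMeasure_real_singleton r n

lemma poissonMass_nonneg (r : ℝ≥0) (n : ℕ) : 0 ≤ poissonMass r n := by
  unfold poissonMass; positivity

lemma poissonMass_pos {r : ℝ≥0} (hr : 0 < r) (n : ℕ) : 0 < poissonMass r n := by
  have : (0 : ℝ) < r := hr
  unfold poissonMass; positivity

lemma hasSum_poissonMass_mul {r : ℝ≥0} {g : ℕ → ℝ} (hg : Integrable g (poissonMeasure r)) :
    HasSum (fun n => poissonMass r n * g n) (∫ n, g n ∂poissonMeasure r) :=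
  hasSum_integral_poissonMeasure hg

lemma poissonMass_succ_mul (r : ℝ≥0) (n : ℕ) :
    poissonMass r (n + 1) * (n + 1 : ℕ) = r * poissonMass r n := by
  have : (n.factorial : ℝ) ≠ 0 := by positivity
  have h' : ((n : ℝ) + 1) ≠ 0 := by positivity
  unfold poissonMass
  rw [Nat.factorial_succ]
  push_cast
  field_simp
  ring

lemma integrable_pow_poissonMeasure (r : ℝ≥0) (k : ℕ) :
    Integrable (fun n : ℕ => (n : ℝ) ^ k) (poissonMeasure r) := by
  rw [integrable_poissonMeasure_iff]
  have hs := (((Real.summable_pow_div_factorial ((r : ℝ) * Real.exp 1)).mul_left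
    (k.factorial : ℝ))).mul_left (Real.exp (-r))
  refine Summable.of_nonneg_of_le (fun n => by positivity) (fun n => ?_) hs
  have h1 : (n : ℝ) ^ k ≤ k.factorial * Real.exp 1 ^ n := by
    have := Real.pow_div_factorial_le_exp (n : ℝ) (by positivity) k
    rw [div_le_iff₀ (by positivity)] at this
    rw [← Real.exp_nat_mul, mul_one]
    linarith
  rw [Real.norm_of_nonneg (by positivity), mul_pow]
  calc _ ≤ Real.exp (-r) * (r : ℝ) ^ n / n.factorial * (k.factorial * Real.exp 1 ^ n) := by gcongr
    _ = _ := by ring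

/-- A function of polynomial growth is integrable against a Poisson distribution. -/
lemma integrable_poissonMeasure_of_growth (r : ℝ≥0) {g : ℕ → ℝ} {C : ℝ} {m : ℕ}
    (hg : ∀ n, |g n| ≤ C * (1 + n) ^ m) : Integrable g (poissonMeasure r) := by
  have h : Integrable (fun n : ℕ => C * (1 + (n : ℝ)) ^ m) (poissonMeasure r) := by
    simp_rw [add_comm (1 : ℝ), add_pow, one_pow, mul_one]
    exact (integrable_finsetSum _ fun i _ =>
      (integrable_pow_poissonMeasure r i).mul_const _).const_mul C
  exact h.mono' .of_discrete (.of_forall fun n => by simpa using hg n)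

/-- The Stein–Chen identity, in centred form. -/
lemma integral_sub_mul_poissonMeasure {r : ℝ≥0} {g : ℕ → ℝ}
    (h0 : Integrable g (poissonMeasure r))
    (h1 : Integrable (fun n : ℕ => (n : ℝ) * g n) (poissonMeasure r))
    (h2 : Integrable (fun n : ℕ => g (n + 1)) (poissonMeasure r)) :
    ∫ n, ((n : ℝ) - r) * g n ∂poissonMeasure r
      = r * ∫ n, (g (n + 1) - g n) ∂poissonMeasure r := by
  have hs : ∫ n, (n : ℝ) * g n ∂poissonMeasure r = r * ∫ n, g (n + 1) ∂poissonMeasure r := by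
    have hs1 := hasSum_poissonMass_mul h1
    have hs2 := (hasSum_poissonMass_mul h2).mul_left (r : ℝ)
    have h3 := (hasSum_nat_add_iff' (f := fun n => poissonMass r n * ((n : ℝ) * g n)) 1).mpr hs1
    simp only [Finset.range_one, Finset.sum_singleton, Nat.cast_zero, zero_mul, mul_zero,
      sub_zero] at h3
    refine h3.unique (hs2.congr_fun fun n => ?_)
    rw [← mul_assoc, poissonMass_succ_mul, mul_assoc]
  rw [integral_sub h2 h0, mul_sub, ← hs, ← integral_const_mul, ← integral_sub h1 (h0.const_mul _)]
  simp_rw [sub_mul]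

lemma abs_sub_pow_le (r : ℝ≥0) (m n : ℕ) :
    |((n : ℝ) - r) ^ m| ≤ (1 + r : ℝ) ^ m * (1 + n) ^ m := by
  rw [abs_pow, ← mul_pow]
  refine pow_le_pow_left₀ (abs_nonneg _) ?_ _
  have h1 : (0 : ℝ) ≤ n := by positivity
  have h2 : (0 : ℝ) ≤ r := r.2
  rw [abs_le]; constructor <;> nlinarith

lemma integrable_sub_pow_poissonMeasure (r : ℝ≥0) (m : ℕ) :
    Integrable (fun n : ℕ => ((n : ℝ) - r) ^ m) (poissonMeasure r) :=
  integrable_poissonMeasure_of_growth r (abs_sub_pow_le r m)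

/-- Recursion for the central moments of the Poisson distribution. -/
lemma integral_sub_pow_succ_poissonMeasure (r : ℝ≥0) (m : ℕ) :
    ∫ n, ((n : ℝ) - r) ^ (m + 1) ∂poissonMeasure r
      = r * ∫ n : ℕ, (((n : ℝ) - r + 1) ^ m - ((n : ℝ) - r) ^ m) ∂poissonMeasure r := by
  have h0 := integrable_sub_pow_poissonMeasure r m
  have h1 : Integrable (fun n : ℕ => (n : ℝ) * ((n : ℝ) - r) ^ m) (poissonMeasure r) := by
    refine ((integrable_sub_pow_poissonMeasure r (m + 1)).add (h0.const_mul r)).congr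
      (.of_forall fun n => ?_)
    simp only [Pi.add_apply]; ring
  have h2 : Integrable (fun n : ℕ => (((n + 1 : ℕ) : ℝ) - r) ^ m) (poissonMeasure r) := by
    refine integrable_poissonMeasure_of_growth r (C := (1 + r : ℝ) ^ m * 2 ^ m) (m := m)
      fun n => (abs_sub_pow_le r m (n + 1)).trans ?_
    rw [mul_assoc, ← mul_pow 2]
    push_cast
    gcongr
    linarith [(Nat.cast_nonneg n : (0 : ℝ) ≤ n)]
  have := integral_sub_mul_poissonMeasure h0 h1 h2
  simp_rw [pow_succ', this]
  congr 1
  refine integral_congr_ae (.of_forall fun n => ?_)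
  push_cast
  ring

lemma integral_sub_poissonMeasure (r : ℝ≥0) :
    ∫ n, ((n : ℝ) - r) ∂poissonMeasure r = 0 := by
  simpa using integral_sub_pow_succ_poissonMeasure r 0

lemma integral_sub_sq_poissonMeasure (r : ℝ≥0) :
    ∫ n, ((n : ℝ) - r) ^ 2 ∂poissonMeasure r = r := by
  simpa using integral_sub_pow_succ_poissonMeasure r 1

lemma integral_sub_pow_four_poissonMeasure (r : ℝ≥0) :
    ∫ n, ((n : ℝ) - r) ^ 4 ∂poissonMeasure r = 3 * r ^ 2 + r := by
  have i2 := integrable_sub_pow_poissonMeasure r 2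
  have i1 := integrable_sub_pow_poissonMeasure r 1
  simp only [pow_one] at i1
  rw [integral_sub_pow_succ_poissonMeasure r 3]
  have : ∀ n : ℕ, ((n : ℝ) - r + 1) ^ 3 - ((n : ℝ) - r) ^ 3
      = 3 * ((n : ℝ) - r) ^ 2 + (3 * ((n : ℝ) - r) + 1) := fun n => by ring
  simp_rw [this]
  have i3 : Integrable (fun n : ℕ => 3 * ((n : ℝ) - r) + 1) (poissonMeasure r) :=
    (i1.const_mul 3).add (integrable_const 1)
  rw [integral_add (i2.const_mul 3) i3, integral_add (i1.const_mul 3) (integrable_const 1),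
    integral_const_mul, integral_const_mul,
    integral_sub_sq_poissonMeasure, integral_sub_poissonMeasure]
  simp
  ring

/-- The mass that the binomial distribution with `N` trials of success probability `p` gives
to `k`; it vanishes for `k > N`. -/
noncomputable def binomialMass (N : ℕ) (p : ℝ≥0) (k : ℕ) : ℝ :=
  (N.choose k : ℝ) * (p : ℝ) ^ k * (1 - p : ℝ) ^ (N - k)

lemma binomialMass_nonneg {N : ℕ} {p : ℝ≥0} (hp : p ≤ 1) (k : ℕ) : 0 ≤ binomialMass N p k := by
  have : (0 : ℝ) ≤ 1 - p := sub_nonneg.mpr (by exact_mod_cast hp)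
  unfold binomialMass; positivity

lemma binomialMass_of_lt {N k : ℕ} (p : ℝ≥0) (h : N < k) : binomialMass N p k = 0 := by
  simp [binomialMass, Nat.choose_eq_zero_of_lt h]

lemma sum_binomialMass (N : ℕ) (p : ℝ≥0) :
    ∑ k ∈ Finset.range (N + 1), binomialMass N p k = 1 := by
  have := add_pow (p : ℝ) (1 - p) N
  rw [add_sub_cancel, one_pow] at this
  rw [this]
  exact Finset.sum_congr rfl fun k _ => by rw [binomialMass]; ring

/-- Adding one trial to a binomial distribution, by Pascal's rule. -/
lemma sum_binomialMass_succ (N : ℕ) (p : ℝ≥0) (g : ℕ → ℝ) :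
    ∑ k ∈ Finset.range (N + 2), binomialMass (N + 1) p k * g k
      = ∑ k ∈ Finset.range (N + 1), binomialMass N p k * ((1 - p) * g k + p * g (k + 1)) := by
  have h := Finset.sum_antidiagonal_choose_succ_mul
    (fun i j => (p : ℝ) ^ i * (1 - p : ℝ) ^ j * g i) N
  rw [Finset.Nat.sum_antidiagonal_eq_sum_range_succ
      (fun i j => ((N + 1).choose i : ℝ) * ((p : ℝ) ^ i * (1 - p : ℝ) ^ j * g i)),
    Finset.Nat.sum_antidiagonal_eq_sum_range_succ
      (fun i j => (N.choose i : ℝ) * ((p : ℝ) ^ i * (1 - p : ℝ) ^ (j + 1) * g i)),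
    Finset.Nat.sum_antidiagonal_eq_sum_range_succ
      (fun i j => (N.choose j : ℝ) * ((p : ℝ) ^ (i + 1) * (1 - p : ℝ) ^ j * g (i + 1))),
    ← Finset.sum_add_distrib] at h
  refine Eq.trans (Finset.sum_congr rfl fun k _ => ?_)
    (h.trans (Finset.sum_congr rfl fun k hk => ?_))
  · rw [binomialMass]; ring
  · rw [Nat.choose_symm (Finset.mem_range_succ_iff.mp hk), binomialMass]; ring

/-- A convex function on `ℕ` lies above its chord through `0` and `1`. -/
lemma add_mul_sub_le_of_convex {g : ℕ → ℝ} (hg : ∀ n, 2 * g (n + 1) ≤ g n + g (n + 2)) (n : ℕ) :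
    g 0 + n * (g 1 - g 0) ≤ g n := by
  have hinc : ∀ n, g 1 - g 0 ≤ g (n + 1) - g n := fun n => by
    induction n with
    | zero => simp
    | succ n ih => linarith [hg n]
  induction n with
  | zero => simp
  | succ n ih => push_cast; linarith [hinc n]

/-- The convex order between a Bernoulli and a Poisson distribution of the same mean. -/
lemma bernoulli_le_integral_poissonMeasure {p : ℝ≥0} {g : ℕ → ℝ} {C : ℝ}
    (hg : ∀ n, 2 * g (n + 1) ≤ g n + g (n + 2)) (hC : ∀ n, |g n| ≤ C * (1 + n) ^ 2) :
    (1 - p) * g 0 + p * g 1 ≤ ∫ n, g n ∂poissonMeasure p := by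
  have i1 := integrable_sub_pow_poissonMeasure p 1
  simp only [pow_one] at i1
  have hi : Integrable (fun n : ℕ => (g 0 + p * (g 1 - g 0)) + ((n : ℝ) - p) * (g 1 - g 0))
    (poissonMeasure p) := (integrable_const _).add (i1.mul_const _)
  calc (1 - p) * g 0 + p * g 1
      = ∫ n : ℕ, ((g 0 + p * (g 1 - g 0)) + ((n : ℝ) - p) * (g 1 - g 0)) ∂poissonMeasure p := by
        rw [integral_add (integrable_const _) (i1.mul_const _), integral_mul_const,
          integral_sub_poissonMeasure]
        simp
        ring
    _ ≤ _ := by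
        refine integral_mono hi (integrable_poissonMeasure_of_growth p hC) fun n => ?_
        have := add_mul_sub_le_of_convex hg n
        simp only
        linarith

/-- The convex order between a binomial and a Poisson distribution of the same mean: a binomial
variable is a sum of Bernoulli variables, and a Poisson variable one of Poisson variables. -/
lemma sum_binomialMass_mul_le_integral_poissonMeasure (N : ℕ) {p : ℝ≥0} (hp : p ≤ 1) {g : ℕ → ℝ}
    {C : ℝ} (hg : ∀ n, 2 * g (n + 1) ≤ g n + g (n + 2)) (hC : ∀ n, |g n| ≤ C * (1 + n) ^ 2) :
    ∑ k ∈ Finset.range (N + 1), binomialMass N p k * g k ≤ ∫ n, g n ∂poissonMeasure (N * p) := by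
  have hp' : (0 : ℝ) ≤ 1 - p := sub_nonneg.mpr (by exact_mod_cast hp)
  have hp0 : (0 : ℝ) ≤ p := p.2
  induction N generalizing g C with
  | zero =>
    have h : poissonMeasure 0 = Measure.dirac 0 := by
      refine Measure.ext_of_singleton fun n => ?_
      rw [poissonMeasure_singleton]
      rcases n with _ | n <;> simp
    simp [binomialMass, h]
  | succ N ih =>
    have hC0 : 0 ≤ C := by simpa using (abs_nonneg _).trans (hC 0)
    have hshift : ∀ x y : ℕ, |g (x + y)| ≤ C * (1 + x) ^ 2 * (1 + y) ^ 2 := fun x y => by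
      refine (hC (x + y)).trans ?_
      rw [mul_assoc, ← mul_pow]
      push_cast
      gcongr
      nlinarith [(Nat.cast_nonneg x : (0 : ℝ) ≤ x), (Nat.cast_nonneg y : (0 : ℝ) ≤ y)]
    have hg1 : ∀ k : ℕ, |(1 - p) * g k + p * g (k + 1)| ≤ (5 * C) * (1 + k) ^ 2 := fun k => by
      have h1 := abs_le.mp (hC k)
      have h2 := abs_le.mp (hshift k 1)
      have h3 : 0 ≤ C * (1 + (k : ℝ)) ^ 2 := by positivity
      have h4 : (p : ℝ) ≤ 1 := by linarith
      push_cast at h2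
      rw [abs_le]
      constructor <;> nlinarith
    have hcc : ((N + 1 : ℕ) * p : ℝ≥0) = N * p + p := by push_cast; ring
    have hint : Integrable g ((poissonMeasure (N * p)).conv (poissonMeasure p)) := by
      rw [poissonMeasure_conv_poissonMeasure]
      exact integrable_poissonMeasure_of_growth _ hC
    rw [sum_binomialMass_succ, hcc, ← poissonMeasure_conv_poissonMeasure, integral_conv hint]
    refine (ih (fun n => ?_) hg1).trans ?_
    · nlinarith [mul_le_mul_of_nonneg_left (hg n) hp', mul_le_mul_of_nonneg_left (hg (n + 1)) hp0]
    · refine integral_mono (integrable_poissonMeasure_of_growth _ hg1) ?_ fun x => ?_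
      · refine integrable_poissonMeasure_of_growth _ (m := 2)
          (C := C * ∫ y : ℕ, (1 + (y : ℝ)) ^ 2 ∂poissonMeasure p) fun x => ?_
        have hi : Integrable (fun y : ℕ => (1 + (y : ℝ)) ^ 2) (poissonMeasure p) :=
          integrable_poissonMeasure_of_growth p (C := 1) (m := 2) fun n => by
            rw [abs_of_nonneg (by positivity), one_mul]
        refine (norm_integral_le_of_norm_le (f := fun y => g (x + y))
          (hi.const_mul (C * (1 + (x : ℝ)) ^ 2)) (.of_forall fun y => hshift x y)).trans ?_
        rw [integral_const_mul]
        exact le_of_eq (by ring)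
      · exact bernoulli_le_integral_poissonMeasure (g := fun y => g (x + y))
          (fun n => hg (x + n)) (hshift x)

/-- The mode of a Poisson distribution of integer mean has mass decreasing in the mean. -/
lemma antitone_poissonMass_self : Antitone fun n : ℕ => poissonMass n n := by
  refine antitone_nat_of_succ_le fun n => ?_
  -- the ratio of consecutive masses is `(1 + 1 / n) ^ n / e`
  have h : ((n : ℝ) + 1) ^ n ≤ Real.exp 1 * (n : ℝ) ^ n := by
    rcases Nat.eq_zero_or_pos n with rfl | hn
    · simp
    · have hn' : (0 : ℝ) < n := by exact_mod_cast hn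
      have h1 : (1 : ℝ) + 1 / n ≤ Real.exp (1 / n) := by
        linarith [Real.add_one_le_exp (1 / (n : ℝ))]
      have h2 := pow_le_pow_left₀ (by positivity) h1 n
      rw [← Real.exp_nat_mul, mul_one_div_cancel hn'.ne'] at h2
      calc ((n : ℝ) + 1) ^ n = (1 + 1 / n) ^ n * (n : ℝ) ^ n := by
            rw [← mul_pow]; congr 1; field_simp
        _ ≤ _ := by gcongr
  unfold poissonMass
  rw [Nat.factorial_succ, div_le_div_iff₀ (by positivity) (by positivity)]
  push_cast
  have he : Real.exp (-(n : ℝ)) = Real.exp (-((n : ℝ) + 1)) * Real.exp 1 := by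
    rw [← Real.exp_add]; congr 1; ring
  rw [he, pow_succ]
  have : (0 : ℝ) ≤ Real.exp (-((n : ℝ) + 1)) * (n + 1) * n.factorial := by positivity
  nlinarith [mul_le_mul_of_nonneg_left h this]

/-- Sub-Gaussian lower bound for the Poisson masses: the relative entropy
`m * log (m / r) - m + r` is at most `(m - r) ^ 2 / r`. -/
lemma poissonMass_self_mul_exp_le {r : ℝ≥0} (hr : 0 < r) (m : ℕ) :
    poissonMass m m * Real.exp (-((m : ℝ) - r) ^ 2 / r) ≤ poissonMass r m := by
  have hr' : (0 : ℝ) < r := hr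
  have h : (m : ℝ) ^ m * Real.exp (-(m : ℝ) + -((m : ℝ) - r) ^ 2 / r)
      ≤ Real.exp (-r) * (r : ℝ) ^ m := by
    have h1 : (m : ℝ) / r ≤ Real.exp (m / r - 1) := by
      linarith [Real.add_one_le_exp ((m : ℝ) / r - 1)]
    have h2 := pow_le_pow_left₀ (by positivity) h1 m
    rw [← Real.exp_nat_mul, div_pow, div_le_iff₀ (by positivity)] at h2
    calc _ ≤ Real.exp (m * (m / r - 1)) * (r : ℝ) ^ m
            * Real.exp (-(m : ℝ) + -((m : ℝ) - r) ^ 2 / r) := by gcongr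
      _ = Real.exp (m * (m / r - 1) + (-(m : ℝ) + -((m : ℝ) - r) ^ 2 / r)) * (r : ℝ) ^ m := by
          rw [Real.exp_add (_ * _)]; ring
      _ = _ := by congr 2; field_simp; ring
  unfold poissonMass
  rw [Real.exp_add] at h
  rw [div_mul_eq_mul_div]
  refine div_le_div_of_nonneg_right (le_trans (le_of_eq ?_) h) (by positivity)
  push_cast
  ring

/-- A crude form of Stirling's bound on the mass of the mode of a Poisson distribution. -/
lemma exp_neg_one_div_le_poissonMass_self (n : ℕ) :
    Real.exp (-1) / (1 + n) ≤ poissonMass n n := by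
  rcases Nat.eq_zero_or_pos n with rfl | hn
  · simp [poissonMass]
  -- the mass times the mean is increasing in the mean, because `e ≤ (1 + 1 / n) ^ (n + 1)`
  have key : ∀ n : ℕ, Real.exp (-1) ≤ poissonMass (n + 1 : ℕ) (n + 1) * (n + 1) := by
    intro n
    induction n with
    | zero => simp [poissonMass]
    | succ n ih =>
      refine ih.trans ?_
      have h : Real.exp 1 * ((n : ℝ) + 1) ^ (n + 2) ≤ ((n : ℝ) + 2) ^ (n + 2) := by
        have h1 : ((n : ℝ) + 1) / (n + 2) ≤ Real.exp (-(1 / (n + 2))) := by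
          have := Real.add_one_le_exp (-(1 / ((n : ℝ) + 2)))
          refine le_trans (le_of_eq ?_) this
          field_simp
          ring
        have h2 := pow_le_pow_left₀ (by positivity) h1 (n + 2)
        rw [← Real.exp_nat_mul, div_pow, div_le_iff₀ (by positivity)] at h2
        have h3 : ((n + 2 : ℕ) : ℝ) * (-(1 / ((n : ℝ) + 2))) = -1 := by push_cast; field_simp
        rw [h3] at h2
        calc _ ≤ Real.exp 1 * (Real.exp (-1) * ((n : ℝ) + 2) ^ (n + 2)) := by gcongr
          _ = _ := by rw [← mul_assoc, ← Real.exp_add]; simp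
      unfold poissonMass
      rw [Nat.factorial_succ (n + 1)]
      push_cast
      rw [div_mul_eq_mul_div, div_mul_eq_mul_div, div_le_div_iff₀ (by positivity) (by positivity)]
      have he : Real.exp (-((n : ℝ) + 1)) = Real.exp (-((n : ℝ) + 1 + 1)) * Real.exp 1 := by
        rw [← Real.exp_add]; congr 1; ring
      have h4 : ((n : ℝ) + 1 + 1) = n + 2 := by ring
      rw [he, h4]
      have : (0 : ℝ) ≤ Real.exp (-((n : ℝ) + 2)) * (n + 1).factorial * (n + 2) := by positivity
      have h5 := mul_le_mul_of_nonneg_left h this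
      calc _ = Real.exp (-((n : ℝ) + 2)) * (n + 1).factorial * (n + 2)
            * (Real.exp 1 * ((n : ℝ) + 1) ^ (n + 2)) := by ring
        _ ≤ _ := h5
        _ = _ := by ring
  obtain ⟨k, rfl⟩ : ∃ k, n = k + 1 := ⟨n - 1, by omega⟩
  have := key k
  rw [div_le_iff₀ (by positivity)]
  have h0 := poissonMass_nonneg (k + 1 : ℕ) (k + 1)
  push_cast at this h0 ⊢
  nlinarith

/-- Quadratic upper bound on the information content of a Poisson variable. -/
lemma neg_log_poissonMass_le {r : ℝ≥0} (hr : 0 < r) (n : ℕ) :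
    -Real.log (poissonMass r n) ≤ ((n : ℝ) - r) ^ 2 / r + Real.log (1 + n) + 1 := by
  have h : Real.exp (-1) / (1 + n) * Real.exp (-((n : ℝ) - r) ^ 2 / r) ≤ poissonMass r n :=
    le_trans (mul_le_mul_of_nonneg_right (exp_neg_one_div_le_poissonMass_self n)
      (Real.exp_nonneg _)) (poissonMass_self_mul_exp_le hr n)
  have h' := Real.log_le_log (by positivity) h
  rw [Real.log_mul (by positivity) (by positivity), Real.log_div (by positivity) (by positivity),
    Real.log_exp, Real.log_exp, neg_div] at h'
  linarith

/-- A binomial distribution is a Poisson one conditioned on the sum with an independent Poisson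
variable. -/
lemma binomialMass_mul_poissonMass {N k : ℕ} (hk : k ≤ N) (hN : N ≠ 0) {r s : ℝ≥0}
    (hrs : r + s = N) :
    binomialMass N (r / N) k * poissonMass N N = poissonMass r k * poissonMass s (N - k) := by
  have hN' : (N : ℝ) ≠ 0 := by exact_mod_cast hN
  have hrs' : (r : ℝ) + s = N := by exact_mod_cast hrs
  have h1 : (1 - (r / N : ℝ≥0) : ℝ) = s / N := by
    push_cast; rw [eq_div_iff hN', sub_mul, div_mul_cancel₀ _ hN']; linarith
  have hch : (N.choose k : ℝ) = N.factorial / (k.factorial * (N - k).factorial) :=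
    Nat.cast_choose ℝ hk
  have hpow : (N : ℝ) ^ N = (N : ℝ) ^ k * (N : ℝ) ^ (N - k) := by
    rw [← pow_add, Nat.add_sub_cancel' hk]
  have he : Real.exp (-(N : ℝ)) = Real.exp (-r) * Real.exp (-s) := by
    rw [← Real.exp_add, ← hrs']; congr 1; ring
  unfold binomialMass poissonMass
  rw [h1, hch]
  push_cast
  rw [he, hpow, div_pow, div_pow]
  have : (N.factorial : ℝ) ≠ 0 := by positivity
  field_simp

/-- The binomial mass is bounded below by the Poisson one, up to a relative error quadratic in
the distance to the mean. -/
lemma poissonMass_mul_le_binomialMass {N : ℕ} (hN : N ≠ 0) {r s : ℝ≥0} (hs : 0 < s)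
    (hrs : r + s = N) (k : ℕ) :
    poissonMass r k * (1 - ((k : ℝ) - r) ^ 2 / s) ≤ binomialMass N (r / N) k := by
  have hs' : (0 : ℝ) < s := hs
  have hrs' : (r : ℝ) + s = N := by exact_mod_cast hrs
  rcases le_or_gt k N with hk | hk
  · have hNpos : 0 < poissonMass N N := poissonMass_pos (by exact_mod_cast Nat.pos_of_ne_zero hN) N
    refine le_of_mul_le_mul_right ?_ hNpos
    rw [binomialMass_mul_poissonMass hk hN hrs, mul_assoc]
    refine mul_le_mul_of_nonneg_left ?_ (poissonMass_nonneg r k)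
    have h1 := poissonMass_self_mul_exp_le hs (N - k)
    have h2 : poissonMass N N ≤ poissonMass (N - k : ℕ) (N - k) :=
      antitone_poissonMass_self (Nat.sub_le N k)
    have h3 : ((N - k : ℕ) : ℝ) - s = -((k : ℝ) - r) := by
      rw [Nat.cast_sub hk]; linarith
    rw [h3, neg_sq] at h1
    have h4 := Real.add_one_le_exp (-((k : ℝ) - r) ^ 2 / s)
    rw [neg_div] at h4 h1
    calc _ ≤ Real.exp (-(((k : ℝ) - r) ^ 2 / s)) * poissonMass N N :=
          mul_le_mul_of_nonneg_right (by linarith) hNpos.le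
      _ ≤ Real.exp (-(((k : ℝ) - r) ^ 2 / s)) * poissonMass (N - k : ℕ) (N - k) := by gcongr
      _ ≤ _ := by rw [mul_comm]; exact h1
  -- beyond `N` the binomial mass vanishes, and the left side is not positive
  · rw [binomialMass_of_lt _ hk]
    refine mul_nonpos_of_nonneg_of_nonpos (poissonMass_nonneg r k) ?_
    have hk' : (N : ℝ) + 1 ≤ k := by exact_mod_cast hk
    have : s ≤ ((k : ℝ) - r) ^ 2 := by nlinarith
    rw [sub_nonpos, le_div_iff₀ hs']
    linarith

/-! ### The law of the continuous-time walk -/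

/-- The walk after `n` steps is at `i - j` when it has made `i` steps up and `j` steps down. -/
lemma lintegral_discreteWalkLaw (n : ℕ) (g : ℤ → ℝ≥0∞) :
    ∫⁻ x, g x ∂discreteWalkLaw n
      = ∑ ij ∈ Finset.HasAntidiagonal.antidiagonal n,
          (n.choose ij.1 : ℝ≥0∞) * ((2⁻¹ : ℝ≥0∞) ^ n * g ((ij.1 : ℤ) - ij.2)) := by
  induction n generalizing g with
  | zero => simp [discreteWalkLaw]
  | succ n ih =>
    have h : ∀ x, ∫⁻ y, g (x + y) ∂signLaw = 2⁻¹ * g (x + 1) + 2⁻¹ * g (x - 1) := fun x => by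
      rw [signLaw, lintegral_add_measure, lintegral_smul_measure, lintegral_smul_measure,
        lintegral_dirac, lintegral_dirac]
      rfl
    rw [discreteWalkLaw, Measure.lintegral_conv .of_discrete]
    simp_rw [h]
    rw [ih, Finset.sum_antidiagonal_choose_succ_mul
      (fun i j => (2⁻¹ : ℝ≥0∞) ^ (n + 1) * g ((i : ℤ) - j)), add_comm, ← Finset.sum_add_distrib]
    refine Finset.sum_congr rfl fun ij hij => ?_
    rw [← Finset.HasAntidiagonal.mem_antidiagonal.mp hij, ← Nat.choose_symm_add]
    have h1 : ((ij.1 + 1 : ℕ) : ℤ) - ij.2 = (ij.1 : ℤ) - ij.2 + 1 := by push_cast; ring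
    have h2 : (ij.1 : ℤ) - (ij.2 + 1 : ℕ) = (ij.1 : ℤ) - ij.2 - 1 := by push_cast; ring
    rw [h1, h2, pow_succ]
    ring

/-- Poisson thinning: a Poisson number of indistinguishable items, coloured by fair coins. -/
lemma poissonMass_two_mul (r : ℝ≥0) (i j : ℕ) :
    poissonMass (2 * r) (i + j) * ((i + j).choose i * (2⁻¹ : ℝ) ^ (i + j))
      = poissonMass r i * poissonMass r j := by
  have he : Real.exp (-(2 * (r : ℝ))) = Real.exp (-r) * Real.exp (-r) := by
    rw [← Real.exp_add]; congr 1; ring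
  unfold poissonMass
  rw [Nat.cast_add_choose]
  push_cast
  rw [he, mul_pow, pow_add (r : ℝ), inv_pow]
  have h1 : (i.factorial : ℝ) ≠ 0 := by positivity
  have h2 : (j.factorial : ℝ) ≠ 0 := by positivity
  have h3 : ((i + j).factorial : ℝ) ≠ 0 := by positivity
  field_simp

lemma poissonMeasure_singleton_eq (r : ℝ≥0) (n : ℕ) :
    poissonMeasure r {n} = ENNReal.ofReal (poissonMass r n) := poissonMeasure_singleton r n

/-- At time `2 * r` the continuous-time walk is distributed as the difference of two independent
Poisson variables of mean `r` (its numbers of jumps up and down). -/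
lemma walkLaw_two_mul (r : ℝ≥0) :
    walkLaw (2 * r)
      = ((poissonMeasure r).prod (poissonMeasure r)).map (fun x => (x.1 : ℤ) - x.2) := by
  refine Measure.ext_of_lintegral _ fun g _ => ?_
  rw [walkLaw, Measure.lintegral_bind measurable_from_nat.aemeasurable
    Measurable.of_discrete.aemeasurable, lintegral_map .of_discrete .of_discrete,
    lintegral_prod _ Measurable.of_discrete.aemeasurable, lintegral_countable',
    lintegral_countable']
  simp_rw [lintegral_discreteWalkLaw, lintegral_countable', ← ENNReal.tsum_mul_right]
  rw [← ENNReal.tsum_prod (f := fun i j : ℕ => g ((i : ℤ) - j) * poissonMeasure r {j}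
      * poissonMeasure r {i}), ← Finset.HasAntidiagonal.sigmaAntidiagonalEquivProd.tsum_eq,
    ENNReal.tsum_sigma']
  refine tsum_congr fun n => ?_
  rw [tsum_fintype, Finset.univ_eq_attach, ← Finset.sum_attach, Finset.sum_mul]
  refine Finset.sum_congr rfl fun ij _ => ?_
  obtain ⟨⟨i, j⟩, hij⟩ := ij
  obtain rfl := Finset.HasAntidiagonal.mem_antidiagonal.mp hij
  simp only [Finset.HasAntidiagonal.sigmaAntidiagonalEquivProd_apply]
  have h := congrArg ENNReal.ofReal (poissonMass_two_mul r i j)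
  rw [ENNReal.ofReal_mul (poissonMass_nonneg _ _), ENNReal.ofReal_mul (poissonMass_nonneg _ _),
    ENNReal.ofReal_mul (by positivity), ENNReal.ofReal_pow (by positivity),
    ENNReal.ofReal_inv_of_pos two_pos, ENNReal.ofReal_natCast] at h
  simp_rw [poissonMeasure_singleton_eq]
  rw [ENNReal.ofReal_ofNat] at h
  calc _ = g ((i : ℤ) - j) * (ENNReal.ofReal (poissonMass (2 * r) (i + j))
        * (((i + j).choose i : ℝ≥0∞) * 2⁻¹ ^ (i + j))) := by ring
    _ = _ := by rw [h]; ring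

/-- The mass that the walk at time `2 * r` gives to the site `x`. -/
noncomputable def walkMass (r : ℝ≥0) (x : ℤ) : ℝ := (walkLaw (2 * r)).real {x}

lemma walkMass_nonneg (r : ℝ≥0) (x : ℤ) : 0 ≤ walkMass r x := measureReal_nonneg

lemma walkMass_le_one (r : ℝ≥0) (x : ℤ) : walkMass r x ≤ 1 := measureReal_le_one

/-- The Poisson masses, extended by zero to `ℤ`. -/
noncomputable def intPoissonMass (r : ℝ≥0) (k : ℤ) : ℝ :=
  if 0 ≤ k then poissonMass r k.toNat else 0

lemma intPoissonMass_natCast (r : ℝ≥0) (k : ℕ) : intPoissonMass r k = poissonMass r k := by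
  simp [intPoissonMass]

lemma intPoissonMass_of_neg (r : ℝ≥0) {k : ℤ} (hk : k < 0) : intPoissonMass r k = 0 := by
  simp [intPoissonMass, hk]

lemma intPoissonMass_nonneg (r : ℝ≥0) (k : ℤ) : 0 ≤ intPoissonMass r k := by
  unfold intPoissonMass; split_ifs
  · exact poissonMass_nonneg _ _
  · exact le_rfl

lemma prod_poissonMeasure_singleton (r : ℝ≥0) (x : ℕ × ℕ) :
    ((poissonMeasure r).prod (poissonMeasure r)).real {x}
      = poissonMass r x.1 * poissonMass r x.2 := by
  rw [← Set.singleton_prod_singleton, measureReal_def, Measure.prod_prod, ENNReal.toReal_mul,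
    ← measureReal_def, ← measureReal_def, poissonMeasure_real_singleton_eq,
    poissonMeasure_real_singleton_eq]

lemma walkMass_eq_prod (r : ℝ≥0) (x : ℤ) :
    walkMass r x = ((poissonMeasure r).prod (poissonMeasure r)).real
      {y | (y.1 : ℤ) - y.2 = x} := by
  rw [walkMass, walkLaw_two_mul,
    map_measureReal_apply .of_discrete (measurableSet_singleton x)]
  rfl

lemma sum_poissonMass_mul_le_walkMass (r : ℝ≥0) (x : ℤ) (s : Finset (ℕ × ℕ))
    (hs : ∀ y ∈ s, (y.1 : ℤ) - y.2 = x) :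
    ∑ y ∈ s, poissonMass r y.1 * poissonMass r y.2 ≤ walkMass r x := by
  rw [walkMass_eq_prod]
  simp_rw [← prod_poissonMeasure_singleton]
  rw [sum_measureReal_singleton]
  exact measureReal_mono hs

lemma poissonMass_mul_le_walkMass (r : ℝ≥0) (i j : ℕ) :
    poissonMass r i * poissonMass r j ≤ walkMass r (i - j) := by
  simpa using sum_poissonMass_mul_le_walkMass r (i - j) {(i, j)} (by simp)

lemma sum_walkMass_le_one (r : ℝ≥0) (s : Finset ℤ) : ∑ x ∈ s, walkMass r x ≤ 1 := by
  unfold walkMass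
  rw [sum_measureReal_singleton]
  exact measureReal_le_one

lemma walkMass_pos {r : ℝ≥0} (hr : 0 < r) (x : ℤ) : 0 < walkMass r x := by
  have h := poissonMass_mul_le_walkMass r x.toNat (-x).toNat
  rw [Int.toNat_sub_toNat_neg] at h
  exact (mul_pos (poissonMass_pos hr _) (poissonMass_pos hr _)).trans_le h

/-- The walk masses are the autocorrelation of the Poisson masses. -/
lemma hasSum_walkMass (r : ℝ≥0) (x : ℤ) :
    HasSum (fun k : ℤ => intPoissonMass r k * intPoissonMass r (k + x)) (walkMass r x) := by
  rw [← (Nat.cast_injective (R := ℤ)).hasSum_iff]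
  swap
  · intro k hk
    rw [intPoissonMass_of_neg r, zero_mul]
    by_contra! h0
    exact hk ⟨k.toNat, by simp [h0]⟩
  have hslice : ∀ k : ℕ,
      ((poissonMeasure r) ((fun i => (i, k)) ⁻¹' {y | (y.1 : ℤ) - y.2 = x})).toReal =
        intPoissonMass r (k + x) := fun k => by
    rcases le_or_gt 0 (k + x) with h | h
    · obtain ⟨m, hm⟩ := Int.eq_ofNat_of_zero_le h
      rw [hm, intPoissonMass_natCast, ← poissonMeasure_real_singleton_eq, measureReal_def]
      congr 2
      ext i
      simp only [Set.preimage_ofPred_eq, Set.mem_ofPred_eq, Set.mem_singleton_iff]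
      omega
    · rw [intPoissonMass_of_neg r h]
      have : ((fun i => (i, k)) ⁻¹' {y : ℕ × ℕ | (y.1 : ℤ) - y.2 = x}) = ∅ := by
        ext i
        simp only [Set.preimage_ofPred_eq, Set.mem_ofPred_eq, Set.mem_empty_iff_false, iff_false]
        omega
      simp [this]
  have h1 : ((poissonMeasure r).prod (poissonMeasure r)) {y | (y.1 : ℤ) - y.2 = x}
      = ∑' k : ℕ, (poissonMeasure r) ((fun i => (i, k)) ⁻¹' {y | (y.1 : ℤ) - y.2 = x})
          * poissonMeasure r {k} := by
    rw [Measure.prod_apply_symm .of_discrete, lintegral_countable']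
  rw [walkMass_eq_prod, measureReal_def, h1, ENNReal.tsum_toReal_eq fun k =>
    ENNReal.mul_ne_top (measure_ne_top _ _) (measure_ne_top _ _)]
  have h2 := ENNReal.hasSum_toReal (h1 ▸ measure_ne_top _ _)
  refine h2.congr_fun fun k => ?_
  simp only [Function.comp_apply]
  rw [ENNReal.toReal_mul, hslice, intPoissonMass_natCast, ← measureReal_def,
    poissonMeasure_real_singleton_eq, mul_comm]

/-- Log-concavity of the Poisson masses, as total positivity of order two. -/
lemma intPoissonMass_mul_le (r : ℝ≥0) {k l : ℤ} (hkl : k ≤ l) :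
    intPoissonMass r l * intPoissonMass r (k - 1)
      ≤ intPoissonMass r k * intPoissonMass r (l - 1) := by
  rcases le_or_gt k 0 with hk | hk
  · rw [intPoissonMass_of_neg r (show k - 1 < 0 by omega), mul_zero]
    exact mul_nonneg (intPoissonMass_nonneg _ _) (intPoissonMass_nonneg _ _)
  obtain ⟨i, rfl⟩ : ∃ i : ℕ, k = (i + 1 : ℕ) := ⟨(k - 1).toNat, by omega⟩
  obtain ⟨j, rfl⟩ : ∃ j : ℕ, l = (j + 1 : ℕ) := ⟨(l - 1).toNat, by omega⟩
  have hi : (((i + 1 : ℕ) : ℤ) - 1) = (i : ℕ) := by push_cast; ring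
  have hj : (((j + 1 : ℕ) : ℤ) - 1) = (j : ℕ) := by push_cast; ring
  rw [hi, hj]
  simp only [intPoissonMass_natCast]
  have h1 := poissonMass_succ_mul r i
  have h2 := poissonMass_succ_mul r j
  have hij : ((i + 1 : ℕ) : ℝ) ≤ (j + 1 : ℕ) := by exact_mod_cast hkl
  have hi0 : (0 : ℝ) < (i + 1 : ℕ) := by positivity
  have hj0 : (0 : ℝ) < (j + 1 : ℕ) := by positivity
  rw [← eq_div_iff hi0.ne'] at h1
  rw [← eq_div_iff hj0.ne'] at h2
  rw [h1, h2]
  have hn := mul_nonneg r.2 (mul_nonneg (poissonMass_nonneg r i) (poissonMass_nonneg r j))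
  rw [NNReal.val_eq_coe] at hn
  calc _ = (r * (poissonMass r i * poissonMass r j)) / (j + 1 : ℕ) := by ring
    _ ≤ (r * (poissonMass r i * poissonMass r j)) / (i + 1 : ℕ) := by gcongr
    _ = _ := by ring

/-- The autocorrelation of a log-concave sequence is log-concave. By symmetrization
(the Cauchy–Binet formula) the difference of both sides is half the sum over `k, l` of products
of two `2 × 2` minors of `a`, which have the same sign. -/
lemma autocorrelation_add_one_mul_sub_one_le {a c : ℤ → ℝ} (ha : ∀ k, 0 ≤ a k)
    (hlc : ∀ k l, k ≤ l → a l * a (k - 1) ≤ a k * a (l - 1))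
    (hc : ∀ x, HasSum (fun k => a k * a (k + x)) (c x)) (x : ℤ) :
    c (x + 1) * c (x - 1) ≤ c x * c x := by
  have hshift : ∀ y : ℤ, HasSum (fun l : ℤ => a (l - 1) * a (l - 1 + y)) (c y) :=
    fun y => ((Equiv.subRight (1 : ℤ)).hasSum_iff
      (f := fun k : ℤ => a k * a (k + y))).mpr (hc y)
  have hprod : ∀ y y' : ℤ, HasSum
      (fun z : ℤ × ℤ => (a z.1 * a (z.1 + y)) * (a (z.2 - 1) * a (z.2 - 1 + y')))
      (c y * c y') := fun y y' =>
    (hc y).mul (hshift y') ((hc y).summable.mul_of_nonneg (hshift y').summable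
      (fun k => mul_nonneg (ha _) (ha _)) (fun k => mul_nonneg (ha _) (ha _)))
  have h3 := (hprod x x).sub (hprod (x - 1) (x + 1))
  have h4 := h3.add ((Equiv.prodComm ℤ ℤ).hasSum_iff.mpr h3)
  have h5 : 0 ≤ c x * c x - c (x - 1) * c (x + 1) + (c x * c x - c (x - 1) * c (x + 1)) := by
    refine HasSum.nonneg ?_ h4
    rintro ⟨k, l⟩
    have e1 : l - 1 + (x + 1) = l + x := by ring
    have e2 : k + (x - 1) = k + x - 1 := by ring
    have e3 : l - 1 + x = l + x - 1 := by ring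
    have e4 : k - 1 + (x + 1) = k + x := by ring
    have e5 : l + (x - 1) = l + x - 1 := by ring
    have e6 : k - 1 + x = k + x - 1 := by ring
    simp only [Function.comp_apply, Equiv.prodComm_apply, Prod.swap_prod_mk, e1, e2, e3, e4, e5, e6]
    have hfac : 0 ≤ (a k * a (l - 1) - a l * a (k - 1))
        * (a (k + x) * a (l + x - 1) - a (l + x) * a (k + x - 1)) := by
      rcases le_total k l with h | h
      · exact mul_nonneg (sub_nonneg.mpr (hlc _ _ h)) (sub_nonneg.mpr (hlc _ _ (by omega)))
      · have h1 := hlc _ _ h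
        have h2 := hlc (l + x) (k + x) (by omega)
        exact mul_nonneg_of_nonpos_of_nonpos (by linarith) (by linarith)
    linarith
  linarith

lemma walkMass_add_one_mul_sub_one_le (r : ℝ≥0) (x : ℤ) :
    walkMass r (x + 1) * walkMass r (x - 1) ≤ walkMass r x * walkMass r x :=
  autocorrelation_add_one_mul_sub_one_le (intPoissonMass_nonneg r)
    (fun _ _ => intPoissonMass_mul_le r) (hasSum_walkMass r) x

/-- The information content `-log q(x)` of the site `x` for the walk at time `2 * r`. -/
noncomputable def walkInfo (r : ℝ≥0) (x : ℤ) : ℝ := -Real.log (walkMass r x)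

lemma walkInfo_nonneg (r : ℝ≥0) (x : ℤ) : 0 ≤ walkInfo r x :=
  neg_nonneg.mpr (Real.log_nonpos (walkMass_nonneg r x) (walkMass_le_one r x))

/-- Convexity of the information content, from log-concavity of the walk. -/
lemma two_mul_walkInfo_le {r : ℝ≥0} (hr : 0 < r) (x : ℤ) :
    2 * walkInfo r x ≤ walkInfo r (x - 1) + walkInfo r (x + 1) := by
  have hp := walkMass_pos hr
  have h := Real.log_le_log (mul_pos (hp _) (hp _)) (walkMass_add_one_mul_sub_one_le r x)
  rw [Real.log_mul (hp _).ne' (hp _).ne', Real.log_mul (hp _).ne' (hp _).ne'] at h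
  unfold walkInfo
  linarith

/-- An upper bound for the information content of `n` under the Poisson distribution. -/
noncomputable def poissonInfoBound (r : ℝ≥0) (n : ℕ) : ℝ :=
  ((n : ℝ) - r) ^ 2 / r + Real.log (1 + n) + 1

/-- The walk is at `i - j` if its numbers of jumps up and down are `i` and `j`, so `i - j` carries
at most the information that the pair `(i, j)` does. -/
lemma walkInfo_sub_le {r : ℝ≥0} (hr : 0 < r) (i j : ℕ) :
    walkInfo r (i - j) ≤ poissonInfoBound r i + poissonInfoBound r j := by
  have hi := poissonMass_pos hr i
  have hj := poissonMass_pos hr j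
  have h := Real.log_le_log (mul_pos hi hj) (poissonMass_mul_le_walkMass r i j)
  rw [Real.log_mul hi.ne' hj.ne'] at h
  have h1 := neg_log_poissonMass_le hr i
  have h2 := neg_log_poissonMass_le hr j
  unfold walkInfo poissonInfoBound
  linarith

lemma log_one_add_natCast_nonneg (n : ℕ) : 0 ≤ Real.log (1 + n) :=
  Real.log_nonneg (by linarith [(Nat.cast_nonneg n : (0 : ℝ) ≤ n)])

lemma poissonInfoBound_nonneg (r : ℝ≥0) (n : ℕ) : 0 ≤ poissonInfoBound r n := by
  have := log_one_add_natCast_nonneg n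
  unfold poissonInfoBound
  positivity

lemma poissonInfoBound_growth (r : ℝ≥0) (n : ℕ) :
    poissonInfoBound r n ≤ ((1 + r) ^ 2 / r + 2) * (1 + n) ^ 2 := by
  have hn : (0 : ℝ) ≤ n := by positivity
  have h1 := (le_abs_self _).trans (abs_sub_pow_le r 2 n)
  have h2 : Real.log (1 + n) ≤ 1 + n := (Real.log_le_self (by positivity))
  have h3 : ((n : ℝ) - r) ^ 2 / r ≤ (1 + r : ℝ) ^ 2 * (1 + n) ^ 2 / r := by gcongr
  unfold poissonInfoBound
  calc _ ≤ (1 + r : ℝ) ^ 2 * (1 + n) ^ 2 / r + (1 + n) + 1 := by gcongr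
    _ = (1 + r : ℝ) ^ 2 / r * (1 + n) ^ 2 + (1 + n) + 1 := by ring
    _ ≤ _ := by nlinarith

lemma integrable_poissonInfoBound (r : ℝ≥0) :
    Integrable (poissonInfoBound r) (poissonMeasure r) :=
  integrable_poissonMeasure_of_growth r (m := 2) fun n => by
    rw [abs_of_nonneg (poissonInfoBound_nonneg r n)]
    exact poissonInfoBound_growth r n

lemma integrable_walkInfo_sub {r : ℝ≥0} (hr : 0 < r) :
    Integrable (fun x : ℕ × ℕ => walkInfo r (x.1 - x.2))
      ((poissonMeasure r).prod (poissonMeasure r)) := by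
  have hG := integrable_poissonInfoBound r
  refine ((hG.comp_fst (poissonMeasure r)).add (hG.comp_snd (poissonMeasure r))).mono'
    (Measurable.of_discrete.aestronglyMeasurable) (.of_forall fun x => ?_)
  rw [Real.norm_of_nonneg (walkInfo_nonneg _ _)]
  exact walkInfo_sub_le hr x.1 x.2

lemma walkEntropy_two_mul {r : ℝ≥0} (hr : 0 < r) :
    walkEntropy (2 * r)
      = ∫ i, ∫ j, walkInfo r (i - j) ∂poissonMeasure r ∂poissonMeasure r := by
  have hi := integrable_walkInfo_sub hr
  have hi' : Integrable (walkInfo r) (walkLaw (2 * r)) := by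
    rw [walkLaw_two_mul, integrable_map_measure .of_discrete .of_discrete]
    exact hi
  calc walkEntropy (2 * r) = ∫ x, walkInfo r x ∂walkLaw (2 * r) := by
        rw [integral_countable hi', walkEntropy, shannonEntropy]
        refine tsum_congr fun x => ?_
        rw [Real.negMulLog, walkInfo, walkMass, smul_eq_mul]
        ring
    _ = _ := by
        rw [walkLaw_two_mul, integral_map .of_discrete .of_discrete, integral_prod _ hi]

/-! ### Comparison of binomial and Poisson variables -/

/-- The cross-entropy `E[-log q(U - V)]`, where `U`, `V` are independent binomial variables with
`N` trials and mean `r`, and `q` is the law of the walk at time `2 * r`. -/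
noncomputable def binomialCrossEntropy (N : ℕ) (r : ℝ≥0) : ℝ :=
  ∑ i ∈ Finset.range (N + 1), binomialMass N (r / N) i *
    ∑ j ∈ Finset.range (N + 1), binomialMass N (r / N) j * walkInfo r (i - j)

lemma abs_walkInfo_sub_le {r : ℝ≥0} (hr : 0 < r) (i j : ℕ) :
    |walkInfo r (i - j)| ≤ ((1 + r) ^ 2 / r + 2 + poissonInfoBound r i) * (1 + j) ^ 2 := by
  rw [abs_of_nonneg (walkInfo_nonneg _ _)]
  have h1 := walkInfo_sub_le hr i j
  have h2 := poissonInfoBound_growth r j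
  have h3 := poissonInfoBound_nonneg r i
  have h4 : (1 : ℝ) ≤ (1 + j) ^ 2 := one_le_pow₀ (by linarith [(Nat.cast_nonneg j : (0 : ℝ) ≤ j)])
  nlinarith

lemma integrable_walkInfo_sub_right {r : ℝ≥0} (hr : 0 < r) (i : ℕ) :
    Integrable (fun j : ℕ => walkInfo r (i - j)) (poissonMeasure r) :=
  integrable_poissonMeasure_of_growth r (abs_walkInfo_sub_le hr i)

/-- Convexity of `-log q` and the convex order between binomial and Poisson variables bound the
cross-entropy by the entropy of the walk. -/
lemma binomialCrossEntropy_le {N : ℕ} (hN : N ≠ 0) {r : ℝ≥0} (hr : 0 < r) (hrN : r ≤ N) :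
    binomialCrossEntropy N r ≤ walkEntropy (2 * r) := by
  have hN' : (N : ℝ≥0) ≠ 0 := by exact_mod_cast hN
  have hp : r / N ≤ 1 := div_le_one_of_le₀ hrN (by positivity)
  have hm : N * (r / N) = r := mul_div_cancel₀ r hN'
  have hint := integrable_walkInfo_sub_right hr
  have hinner : ∀ i : ℕ, ∑ j ∈ Finset.range (N + 1),
      binomialMass N (r / N) j * walkInfo r (i - j)
        ≤ ∫ j, walkInfo r (i - j) ∂poissonMeasure r := fun i => by
    have h := sum_binomialMass_mul_le_integral_poissonMeasure N hp
      (g := fun j : ℕ => walkInfo r (i - j)) (fun j => ?_) (abs_walkInfo_sub_le hr i)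
    · rwa [hm] at h
    · have h := two_mul_walkInfo_le hr ((i : ℤ) - (j + 1 : ℕ))
      have e1 : (i : ℤ) - (j + 1 : ℕ) - 1 = i - (j + 2 : ℕ) := by push_cast; ring
      have e2 : (i : ℤ) - (j + 1 : ℕ) + 1 = i - j := by push_cast; ring
      rw [e1, e2] at h
      linarith
  have houter := sum_binomialMass_mul_le_integral_poissonMeasure N hp
    (g := fun i : ℕ => ∫ j, walkInfo r (i - j) ∂poissonMeasure r)
    (C := (1 + r) ^ 2 / r + 2 + ∫ j, poissonInfoBound r j ∂poissonMeasure r)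
    (fun i => ?_) (fun i => ?_)
  · rw [hm] at houter
    rw [walkEntropy_two_mul hr]
    refine le_trans (Finset.sum_le_sum fun i _ => ?_) houter
    exact mul_le_mul_of_nonneg_left (hinner i) (binomialMass_nonneg hp i)
  · rw [← integral_const_mul, ← integral_add (hint i) (hint (i + 2))]
    refine integral_mono ((hint (i + 1)).const_mul 2) ((hint i).add (hint (i + 2))) fun j => ?_
    have h := two_mul_walkInfo_le hr (((i + 1 : ℕ) : ℤ) - j)
    have e1 : ((i + 1 : ℕ) : ℤ) - j - 1 = i - j := by push_cast; ring
    have e2 : ((i + 1 : ℕ) : ℤ) - j + 1 = (i + 2 : ℕ) - j := by push_cast; ring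
    rwa [e1, e2] at h
  · have hB := integrable_poissonInfoBound r
    have h0 : 0 ≤ ∫ j, poissonInfoBound r j ∂poissonMeasure r :=
      integral_nonneg fun j => poissonInfoBound_nonneg r j
    rw [abs_of_nonneg (integral_nonneg fun j => walkInfo_nonneg _ _)]
    have h1 : ∫ j, walkInfo r (i - j) ∂poissonMeasure r
        ≤ ∫ j, (poissonInfoBound r i + poissonInfoBound r j) ∂poissonMeasure r :=
      integral_mono (hint i) ((integrable_const _).add hB) fun j => walkInfo_sub_le hr i j
    rw [integral_add (integrable_const _) hB] at h1
    have h2 := poissonInfoBound_growth r i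
    have h4 : (1 : ℝ) ≤ (1 + i) ^ 2 := one_le_pow₀ (by linarith [(Nat.cast_nonneg i : (0 : ℝ) ≤ i)])
    simp only [integral_const, probReal_univ, one_smul] at h1
    nlinarith

/-- Comparison of binomial and Poisson expectations of a nonnegative function. The factor is
truncated at zero so that the bound can be applied in each of two variables in turn. -/
lemma integral_mul_le_sum_binomialMass {N : ℕ} (hN : N ≠ 0) {r s : ℝ≥0} (hs : 0 < s)
    (hrs : r + s = N) {F : ℕ → ℝ} (hF0 : ∀ n, 0 ≤ F n)
    (hF : Integrable (fun n : ℕ => max (1 - ((n : ℝ) - r) ^ 2 / s) 0 * F n) (poissonMeasure r)) :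
    ∫ n, max (1 - ((n : ℝ) - r) ^ 2 / s) 0 * F n ∂poissonMeasure r
      ≤ ∑ k ∈ Finset.range (N + 1), binomialMass N (r / N) k * F k := by
  have hp : r / N ≤ 1 := div_le_one_of_le₀ (by rw [← hrs]; exact le_self_add) (by positivity)
  refine hasSum_le (fun n => ?_) (hasSum_poissonMass_mul hF)
    (hasSum_sum_of_ne_finset_zero (s := Finset.range (N + 1)) fun k hk => ?_)
  · rw [← mul_assoc, mul_max_of_nonneg _ _ (poissonMass_nonneg r n), mul_zero]
    exact mul_le_mul_of_nonneg_right
      (max_le (poissonMass_mul_le_binomialMass hN hs hrs n) (binomialMass_nonneg hp n)) (hF0 n)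
  · rw [binomialMass_of_lt _ (by simpa using hk), zero_mul]

/-- The integral bounding the loss when binomial masses are replaced by Poisson masses. -/
lemma integral_quadratic_prod_poissonMeasure {r : ℝ≥0} (hr : 0 < r) (s L : ℝ) :
    Integrable (fun x : ℕ × ℕ => ((((x.1 : ℝ) - r) ^ 2 + ((x.2 : ℝ) - r) ^ 2) / s)
      * (2 / r * (((x.1 : ℝ) - r) ^ 2 + ((x.2 : ℝ) - r) ^ 2) + 2 * L))
      ((poissonMeasure r).prod (poissonMeasure r)) ∧
    ∫ x : ℕ × ℕ, ((((x.1 : ℝ) - r) ^ 2 + ((x.2 : ℝ) - r) ^ 2) / s)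
      * (2 / r * (((x.1 : ℝ) - r) ^ 2 + ((x.2 : ℝ) - r) ^ 2) + 2 * L)
      ∂((poissonMeasure r).prod (poissonMeasure r)) = (16 * r + 4 + 4 * L * r) / s := by
  have hr' : (r : ℝ) ≠ 0 := by exact_mod_cast hr.ne'
  set μ := poissonMeasure r
  have i2 := integrable_sub_pow_poissonMeasure r 2
  have i4 := integrable_sub_pow_poissonMeasure r 4
  have a1 := i2.comp_fst μ
  have a2 := i2.comp_snd μ
  have b1 := i4.comp_fst μ
  have b2 := i4.comp_snd μ
  have c := i2.mul_prod i2
  have e : ∀ x : ℕ × ℕ, ((((x.1 : ℝ) - r) ^ 2 + ((x.2 : ℝ) - r) ^ 2) / s)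
      * (2 / r * (((x.1 : ℝ) - r) ^ 2 + ((x.2 : ℝ) - r) ^ 2) + 2 * L)
      = 2 / (r * s) * ((x.1 : ℝ) - r) ^ 4 + (2 / (r * s) * ((x.2 : ℝ) - r) ^ 4
        + (4 / (r * s) * (((x.1 : ℝ) - r) ^ 2 * ((x.2 : ℝ) - r) ^ 2)
        + (2 * L / s * ((x.1 : ℝ) - r) ^ 2 + 2 * L / s * ((x.2 : ℝ) - r) ^ 2))) := fun x => by
    field_simp
    ring
  simp_rw [e]
  have j4 := (a1.const_mul (2 * L / s)).add (a2.const_mul (2 * L / s))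
  have j3 := (c.const_mul (4 / (r * s))).add j4
  have j2 := (b2.const_mul (2 / (r * s))).add j3
  have j1 := (b1.const_mul (2 / (r * s))).add j2
  refine ⟨j1, ?_⟩
  refine (integral_add' (b1.const_mul _) j2).trans ?_
  rw [integral_add' (b2.const_mul _) j3, integral_add' (c.const_mul _) j4,
    integral_add' (a1.const_mul _) (a2.const_mul _)]
  simp only [integral_const_mul]
  have f1 : ∀ g : ℕ → ℝ, ∫ x : ℕ × ℕ, g x.1 ∂μ.prod μ = ∫ n, g n ∂μ := fun g => by
    simp [integral_fun_fst (μ := μ) (ν := μ) g]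
  have f2 : ∀ g : ℕ → ℝ, ∫ x : ℕ × ℕ, g x.2 ∂μ.prod μ = ∫ n, g n ∂μ := fun g => by
    simp [integral_fun_snd (μ := μ) (ν := μ) g]
  rw [f1 (fun n => ((n : ℝ) - r) ^ 4), f2 (fun n => ((n : ℝ) - r) ^ 4),
    f1 (fun n => ((n : ℝ) - r) ^ 2), f2 (fun n => ((n : ℝ) - r) ^ 2),
    integral_prod_mul (fun n : ℕ => ((n : ℝ) - r) ^ 2) (fun n : ℕ => ((n : ℝ) - r) ^ 2),
    integral_sub_pow_four_poissonMeasure, integral_sub_sq_poissonMeasure]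
  field_simp
  ring

/-- The logarithmic term in the information bound is absorbed by means of the tangent to the
logarithm at `1 + r`. -/
lemma poissonInfoBound_le {r : ℝ≥0} (hr : 0 < r) (n : ℕ) :
    poissonInfoBound r n ≤ 2 / r * ((n : ℝ) - r) ^ 2 + (Real.log (1 + r) + 2) := by
  have hr' : (0 : ℝ) < r := hr
  have h1 : Real.log (1 + n) ≤ Real.log (1 + r) + ((n : ℝ) - r) / (1 + r) := by
    have h := Real.log_le_sub_one_of_pos (show (0 : ℝ) < (1 + n) / (1 + r) by positivity)
    rw [Real.log_div (by positivity) (by positivity)] at h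
    have e : ((1 : ℝ) + n) / (1 + r) - 1 = ((n : ℝ) - r) / (1 + r) := by field_simp; ring
    linarith
  have h2 : ((n : ℝ) - r) / (1 + r) ≤ 1 + ((n : ℝ) - r) ^ 2 / r := by
    have h3 : ((n : ℝ) - r) / (1 + r) ≤ 1 + (((n : ℝ) - r) / (1 + r)) ^ 2 := by nlinarith
    refine h3.trans ?_
    rw [div_pow]
    gcongr
    nlinarith
  unfold poissonInfoBound
  have e : 2 / r * ((n : ℝ) - r) ^ 2 = ((n : ℝ) - r) ^ 2 / r + ((n : ℝ) - r) ^ 2 / r := by ring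
  linarith

/-- Comparison of the masses shows that the cross-entropy is not much smaller than the entropy
of the walk. -/
lemma walkEntropy_sub_binomialCrossEntropy_le {N : ℕ} (hN : N ≠ 0) {r s : ℝ≥0} (hr : 0 < r)
    (hs : 0 < s) (hrs : r + s = N) :
    walkEntropy (2 * r) - binomialCrossEntropy N r
      ≤ (16 * r + 4 + 4 * (Real.log (1 + r) + 2) * r) / s := by
  have hp : r / N ≤ 1 := div_le_one_of_le₀ (by rw [← hrs]; exact le_self_add) (by positivity)
  set u : ℕ → ℝ := fun n => max (1 - ((n : ℝ) - r) ^ 2 / s) 0 with hu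
  set μ := poissonMeasure r with hμ
  have hu0 : ∀ n, 0 ≤ u n := fun n => le_max_right _ _
  have hu1 : ∀ n, u n ≤ 1 := fun n => max_le (sub_le_self _ (by positivity)) zero_le_one
  have hf0 := walkInfo_nonneg r
  have hint := integrable_walkInfo_sub hr
  have hprod : Integrable (fun x : ℕ × ℕ => u x.1 * (u x.2 * walkInfo r (x.1 - x.2)))
      (μ.prod μ) := by
    refine hint.mono' Measurable.of_discrete.aestronglyMeasurable (.of_forall fun x => ?_)
    rw [Real.norm_of_nonneg (mul_nonneg (hu0 _) (mul_nonneg (hu0 _) (hf0 _)))]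
    exact (mul_le_of_le_one_left (mul_nonneg (hu0 _) (hf0 _)) (hu1 _)).trans
      (mul_le_of_le_one_left (hf0 _) (hu1 _))
  have hinner : ∀ i : ℕ, ∫ j, u j * walkInfo r (i - j) ∂μ ≤ ∑ j ∈ Finset.range (N + 1),
      binomialMass N (r / N) j * walkInfo r (i - j) := fun i => by
    refine integral_mul_le_sum_binomialMass hN hs hrs (fun _ => hf0 _) ?_
    refine (integrable_walkInfo_sub_right hr i).mono' Measurable.of_discrete.aestronglyMeasurable
      (.of_forall fun j => ?_)
    rw [Real.norm_of_nonneg (mul_nonneg (hu0 _) (hf0 _))]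
    exact mul_le_of_le_one_left (hf0 _) (hu1 _)
  have hG : Integrable (fun i : ℕ => u i * ∫ j, u j * walkInfo r (i - j) ∂μ) μ := by
    simpa [integral_const_mul] using hprod.integral_prod_left
  have h1 : ∫ x : ℕ × ℕ, u x.1 * (u x.2 * walkInfo r (x.1 - x.2)) ∂μ.prod μ
      ≤ binomialCrossEntropy N r := by
    rw [integral_prod _ hprod]
    simp only [integral_const_mul]
    refine (integral_mul_le_sum_binomialMass hN hs hrs (fun i =>
      integral_nonneg fun j => mul_nonneg (hu0 _) (hf0 _)) hG).trans ?_
    exact Finset.sum_le_sum fun i _ =>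
      mul_le_mul_of_nonneg_left (hinner i) (binomialMass_nonneg hp i)
  have h2 : walkEntropy (2 * r) = ∫ x : ℕ × ℕ, walkInfo r (x.1 - x.2) ∂μ.prod μ := by
    rw [walkEntropy_two_mul hr, integral_prod _ hint]
  obtain ⟨hqi, hq⟩ := integral_quadratic_prod_poissonMeasure hr s (Real.log (1 + r) + 2)
  rw [h2, ← hq]
  refine (sub_le_sub_left h1 _).trans ?_
  rw [← integral_sub hint hprod]
  refine integral_mono (hint.sub hprod) hqi fun x => ?_
  obtain ⟨i, j⟩ := x
  simp only
  have hi : 1 - ((i : ℝ) - r) ^ 2 / s ≤ u i := le_max_left _ _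
  have hj : 1 - ((j : ℝ) - r) ^ 2 / s ≤ u j := le_max_left _ _
  have h3 : 1 - u i * u j ≤ (((i : ℝ) - r) ^ 2 + ((j : ℝ) - r) ^ 2) / s := by
    rw [add_div]
    nlinarith [mul_nonneg (sub_nonneg.mpr (hu1 i)) (sub_nonneg.mpr (hu1 j))]
  have h4 := walkInfo_sub_le hr i j
  have h5 := poissonInfoBound_le hr i
  have h6 := poissonInfoBound_le hr j
  calc walkInfo r (i - j) - u i * (u j * walkInfo r (i - j))
      = (1 - u i * u j) * walkInfo r (i - j) := by ring
    _ ≤ ((((i : ℝ) - r) ^ 2 + ((j : ℝ) - r) ^ 2) / s) * walkInfo r (i - j) :=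
        mul_le_mul_of_nonneg_right h3 (hf0 _)
    _ ≤ _ := by
        refine mul_le_mul_of_nonneg_left ?_ (by positivity)
        linarith

/-! ### Differences of multinomial vectors -/

/-- Two expressions of a polynomial give the same value under the linear functional that maps
`X ^ n` to `g n`. -/
lemma sum_mul_eq_of_polynomial_eq {α β : Type*} {s : Finset α} {t : Finset β} {c : α → ℝ}
    {c' : β → ℝ} {e : α → ℕ} {e' : β → ℕ}
    (h : ∑ a ∈ s, Polynomial.C (c a) * Polynomial.X ^ e a
      = ∑ b ∈ t, Polynomial.C (c' b) * Polynomial.X ^ e' b) (g : ℕ → ℝ) :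
    ∑ a ∈ s, c a * g (e a) = ∑ b ∈ t, c' b * g (e' b) := by
  have hL : ∀ (a : ℝ) (n : ℕ), (Polynomial.basisMonomials ℝ).constr ℝ g
      (Polynomial.C a * Polynomial.X ^ n) = a * g n := fun a n => by
    have h1 := (Polynomial.basisMonomials ℝ).constr_basis ℝ g n
    rw [Polynomial.coe_basisMonomials] at h1
    rw [Polynomial.C_mul_X_pow_eq_monomial, ← mul_one a, ← smul_eq_mul a 1,
      ← Polynomial.smul_monomial, map_smul, h1, smul_eq_mul, smul_eq_mul, mul_one]
  have h2 := congrArg ((Polynomial.basisMonomials ℝ).constr ℝ g) h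
  simpa only [map_sum, hL] using h2

/-- The mass of `x` under the multinomial distribution with `N` trials and uniform parameter,
for `x` with `∑ i, x i = N`. -/
noncomputable def uniformMultinomialMass {d : ℕ} (x : Fin d → ℕ) : ℝ :=
  (Nat.multinomial Finset.univ x : ℝ) * ∏ i, (1 / (d : ℝ)) ^ x i

lemma uniformMultinomialMass_nonneg {d : ℕ} (x : Fin d → ℕ) : 0 ≤ uniformMultinomialMass x := by
  unfold uniformMultinomialMass; positivity

/-- The coordinates of a uniform multinomial vector are binomial. The generating function of the
`i`-th coordinate is obtained from the multinomial theorem by marking the `i`-th summand. -/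
lemma sum_uniformMultinomialMass_mul {d : ℕ} (N : ℕ) (i : Fin d) (g : ℕ → ℝ) :
    ∑ x ∈ Finset.piAntidiag (Finset.univ : Finset (Fin d)) N, uniformMultinomialMass x * g (x i)
      = ∑ k ∈ Finset.range (N + 1), binomialMass N (1 / d) k * g k := by
  have hd : (d : ℝ) ≠ 0 := by
    have := i.pos
    positivity
  refine sum_mul_eq_of_polynomial_eq ?_ g
  set p : ℝ := 1 / d with hp
  have hsum : ∑ j : Fin d, (Polynomial.C p * if j = i then Polynomial.X else 1)
      = Polynomial.C p * Polynomial.X + Polynomial.C (1 - p) := by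
    have h : ∀ j : Fin d, (Polynomial.C p * if j = i then Polynomial.X else 1)
        = Polynomial.C p + if j = i then Polynomial.C p * (Polynomial.X - 1) else 0 := fun j => by
      split_ifs <;> ring
    simp_rw [h]
    rw [Finset.sum_add_distrib, Finset.sum_ite_eq' Finset.univ i, Finset.sum_const,
      Finset.card_univ, Fintype.card_fin, if_pos (Finset.mem_univ i), nsmul_eq_mul,
      ← Polynomial.C_eq_natCast, ← Polynomial.C_mul]
    have h1 : (d : ℝ) * p = 1 := by rw [hp]; field_simp
    rw [h1, Polynomial.C_sub]
    ring
  have h := Finset.sum_pow_eq_sum_piAntidiag (Finset.univ : Finset (Fin d))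
    (fun j => Polynomial.C p * if j = i then Polynomial.X else 1) N
  rw [hsum, add_pow] at h
  refine Eq.trans (Finset.sum_congr rfl fun x _ => ?_)
    (h.symm.trans (Finset.sum_congr rfl fun k _ => ?_))
  · simp_rw [mul_pow]
    have h2 : ∏ j : Fin d, (if j = i then (Polynomial.X : Polynomial ℝ) else 1) ^ x j
        = Polynomial.X ^ x i := by
      simp_rw [ite_pow, one_pow]
      rw [Finset.prod_ite_eq' Finset.univ i, if_pos (Finset.mem_univ i)]
    rw [Finset.prod_mul_distrib, h2, uniformMultinomialMass, Polynomial.C_mul, map_prod,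
      ← Polynomial.C_eq_natCast, mul_assoc]
    simp_rw [Polynomial.C_pow]
    rfl
  · have hp' : ((1 / d : ℝ≥0) : ℝ) = p := by push_cast; rfl
    rw [binomialMass, hp', mul_pow, Polynomial.C_mul, Polynomial.C_mul, Polynomial.C_pow,
      Polynomial.C_pow, Polynomial.C_eq_natCast]
    ring

lemma sum_uniformMultinomialMass {d : ℕ} (hd : d ≠ 0) (N : ℕ) :
    ∑ x ∈ Finset.piAntidiag (Finset.univ : Finset (Fin d)) N, uniformMultinomialMass x = 1 := by
  have h := sum_uniformMultinomialMass_mul N (⟨0, Nat.pos_of_ne_zero hd⟩ : Fin d) (fun _ => 1)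
  simpa [sum_binomialMass] using h

/-- A uniform multinomial vector has the law of independent Poisson variables conditioned on
their sum. -/
lemma uniformMultinomialMass_mul_poissonMass {d N : ℕ} (hd : d ≠ 0) {x : Fin d → ℕ}
    (hx : x ∈ Finset.piAntidiag Finset.univ N) :
    uniformMultinomialMass x * poissonMass N N = ∏ i, poissonMass (N / d) (x i) := by
  have hd' : (d : ℝ) ≠ 0 := by exact_mod_cast hd
  have hs : ∑ i, x i = N := (Finset.mem_piAntidiag.mp hx).1
  have hm := Nat.multinomial_spec Finset.univ x
  rw [hs] at hm
  have hm' : (∏ i, ((x i).factorial : ℝ)) * Nat.multinomial Finset.univ x = N.factorial := by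
    exact_mod_cast hm
  have hf : (∏ i, ((x i).factorial : ℝ)) ≠ 0 := Finset.prod_ne_zero_iff.mpr fun i _ => by positivity
  have hN : (N.factorial : ℝ) ≠ 0 := by positivity
  unfold uniformMultinomialMass poissonMass
  rw [Finset.prod_div_distrib, Finset.prod_mul_distrib, Finset.prod_const, Finset.card_univ,
    Fintype.card_fin, Finset.prod_pow_eq_pow_sum, Finset.prod_pow_eq_pow_sum, hs,
    ← Real.exp_nat_mul, eq_div_iff hf]
  push_cast
  have he : (d : ℝ) * -((N : ℝ) / d) = -N := by field_simp
  rw [he, ← hm', div_pow, div_pow, one_pow]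
  rw [← hm'] at hN
  have := right_ne_zero_of_mul hN
  field_simp

/-- The mass that the difference of two independent uniform multinomial vectors with `N` trials
gives to `z`. -/
noncomputable def multinomialDiffMass {d : ℕ} (N : ℕ) (z : Fin d → ℤ) : ℝ :=
  ∑ q ∈ Finset.piAntidiag (Finset.univ : Finset (Fin d)) N ×ˢ Finset.piAntidiag Finset.univ N with
    (fun i => (q.1 i : ℤ) - q.2 i) = z, uniformMultinomialMass q.1 * uniformMultinomialMass q.2

/-- A finite set carrying the difference of two multinomial vectors with `N` trials. -/
def multinomialDiffSupport (d N : ℕ) : Finset (Fin d → ℤ) :=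
  (Finset.piAntidiag (Finset.univ : Finset (Fin d)) N ×ˢ Finset.piAntidiag Finset.univ N).image
    fun q i => (q.1 i : ℤ) - q.2 i

lemma multinomialDiffMass_nonneg {d : ℕ} (N : ℕ) (z : Fin d → ℤ) :
    0 ≤ multinomialDiffMass N z :=
  Finset.sum_nonneg fun _ _ =>
    mul_nonneg (uniformMultinomialMass_nonneg _) (uniformMultinomialMass_nonneg _)

lemma multinomialDiffMass_of_notMem {d N : ℕ} {z : Fin d → ℤ}
    (hz : z ∉ multinomialDiffSupport d N) : multinomialDiffMass N z = 0 := by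
  rw [multinomialDiffMass, Finset.filter_eq_empty_iff.mpr, Finset.sum_empty]
  exact fun q hq h => hz (Finset.mem_image.mpr ⟨q, hq, h⟩)

lemma sum_multinomialDiffMass_mul {d : ℕ} (N : ℕ) (φ : (Fin d → ℤ) → ℝ) :
    ∑ z ∈ multinomialDiffSupport d N, multinomialDiffMass N z * φ z
      = ∑ x ∈ Finset.piAntidiag Finset.univ N, uniformMultinomialMass x *
          ∑ y ∈ Finset.piAntidiag Finset.univ N, uniformMultinomialMass y *
            φ fun i => (x i : ℤ) - y i := by
  simp_rw [Finset.mul_sum]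
  rw [← Finset.sum_product', ← Finset.sum_fiberwise_of_maps_to
    (t := multinomialDiffSupport d N)
    (g := fun (q : (Fin d → ℕ) × (Fin d → ℕ)) i => (q.1 i : ℤ) - q.2 i)
    fun q hq => Finset.mem_image_of_mem _ hq]
  refine Finset.sum_congr rfl fun z _ => ?_
  rw [multinomialDiffMass, Finset.sum_mul]
  refine Finset.sum_congr rfl fun q hq => ?_
  rw [(Finset.mem_filter.mp hq).2, mul_assoc]

lemma sum_multinomialDiffMass {d : ℕ} (hd : d ≠ 0) (N : ℕ) :
    ∑ z ∈ multinomialDiffSupport d N, multinomialDiffMass N z = 1 := by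
  have h := sum_multinomialDiffMass_mul (d := d) N fun _ => 1
  simpa [sum_uniformMultinomialMass hd] using h

/-- The expected information content of the multinomial difference under the law of `d`
independent walks is `d` times that of one coordinate. -/
lemma sum_multinomialDiffMass_mul_walkInfo {d N : ℕ} (hN : N ≠ 0) :
    ∑ z ∈ multinomialDiffSupport d N, multinomialDiffMass N z * ∑ i, walkInfo (N / d) (z i)
      = d * binomialCrossEntropy N (N / d) := by
  have hp : (N / d : ℝ≥0) / N = 1 / d := by
    have : (N : ℝ≥0) ≠ 0 := by exact_mod_cast hN
    rw [div_div, mul_comm, ← div_div, div_self this]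
  rw [sum_multinomialDiffMass_mul]
  have h : ∀ i : Fin d, ∑ x ∈ Finset.piAntidiag Finset.univ N, uniformMultinomialMass x *
      ∑ y ∈ Finset.piAntidiag Finset.univ N, uniformMultinomialMass y *
        walkInfo (N / d) ((x i : ℤ) - y i) = binomialCrossEntropy N (N / d) := fun i => by
    rw [binomialCrossEntropy, hp, ← sum_uniformMultinomialMass_mul N i
      (fun k => ∑ j ∈ Finset.range (N + 1), binomialMass N (1 / d) j * walkInfo (N / d) (k - j))]
    refine Finset.sum_congr rfl fun x _ => ?_
    rw [← sum_uniformMultinomialMass_mul N i (fun j => walkInfo (N / d) ((x i : ℤ) - j))]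
  calc _ = ∑ i : Fin d, ∑ x ∈ Finset.piAntidiag Finset.univ N, uniformMultinomialMass x *
      ∑ y ∈ Finset.piAntidiag Finset.univ N, uniformMultinomialMass y *
        walkInfo (N / d) ((x i : ℤ) - y i) := by
        rw [Finset.sum_comm]
        refine Finset.sum_congr rfl fun x _ => ?_
        rw [← Finset.mul_sum]
        congr 1
        rw [Finset.sum_comm]
        exact Finset.sum_congr rfl fun y _ => Finset.mul_sum _ _ _
    _ = _ := by
        rw [Finset.sum_congr rfl fun i _ => h i, Finset.sum_const, Finset.card_univ,
          Fintype.card_fin, nsmul_eq_mul]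

/-- Conditioning on the two sums increases the masses at most by the inverse of the probability
of the conditioning event. -/
lemma multinomialDiffMass_mul_le {d N : ℕ} (hd : d ≠ 0) (z : Fin d → ℤ) :
    multinomialDiffMass N z * poissonMass N N ^ 2 ≤ ∏ i, walkMass (N / d) (z i) := by
  set A : Fin d → Finset (ℕ × ℕ) := fun i =>
    (Finset.range (N + 1) ×ˢ Finset.range (N + 1)).filter fun y => (y.1 : ℤ) - y.2 = z i with hA
  set T := (Finset.piAntidiag (Finset.univ : Finset (Fin d)) N
    ×ˢ Finset.piAntidiag Finset.univ N).filter fun q => (fun i => (q.1 i : ℤ) - q.2 i) = z with hT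
  have hinj : Set.InjOn (fun (q : (Fin d → ℕ) × (Fin d → ℕ)) i => (q.1 i, q.2 i)) T := by
    rintro ⟨x, y⟩ _ ⟨x', y'⟩ _ h
    have h' : ∀ i, x i = x' i ∧ y i = y' i := fun i => by simpa using congrFun h i
    exact Prod.ext (funext fun i => (h' i).1) (funext fun i => (h' i).2)
  have hle : ∀ x ∈ Finset.piAntidiag (Finset.univ : Finset (Fin d)) N, ∀ i, x i < N + 1 :=
    fun x hx i => by
      rw [Nat.lt_succ_iff, ← (Finset.mem_piAntidiag.mp hx).1]
      exact Finset.single_le_sum (f := x) (fun _ _ => Nat.zero_le _) (Finset.mem_univ i)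
  calc multinomialDiffMass N z * poissonMass N N ^ 2
      = ∑ q ∈ T, ∏ i, (poissonMass (N / d) (q.1 i) * poissonMass (N / d) (q.2 i)) := by
        rw [multinomialDiffMass, Finset.sum_mul]
        refine Finset.sum_congr rfl fun q hq => ?_
        obtain ⟨h1, h2⟩ := Finset.mem_product.mp (Finset.mem_filter.mp hq).1
        rw [Finset.prod_mul_distrib, ← uniformMultinomialMass_mul_poissonMass hd h1,
          ← uniformMultinomialMass_mul_poissonMass hd h2]
        ring
    _ = ∑ v ∈ T.image (fun q i => (q.1 i, q.2 i)),
          ∏ i, (poissonMass (N / d) (v i).1 * poissonMass (N / d) (v i).2) :=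
        (Finset.sum_image (f := fun v : Fin d → ℕ × ℕ =>
          ∏ i, (poissonMass (N / d) (v i).1 * poissonMass (N / d) (v i).2)) hinj).symm
    _ ≤ ∑ v ∈ Fintype.piFinset A,
          ∏ i, (poissonMass (N / d) (v i).1 * poissonMass (N / d) (v i).2) := by
        refine Finset.sum_le_sum_of_subset_of_nonneg (fun v hv => ?_) fun v _ _ =>
          Finset.prod_nonneg fun i _ => mul_nonneg (poissonMass_nonneg _ _) (poissonMass_nonneg _ _)
        obtain ⟨q, hq, rfl⟩ := Finset.mem_image.mp hv
        obtain ⟨h0, h3⟩ := Finset.mem_filter.mp hq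
        obtain ⟨h1, h2⟩ := Finset.mem_product.mp h0
        refine Fintype.mem_piFinset.mpr fun i => Finset.mem_filter.mpr
          ⟨Finset.mem_product.mpr ⟨Finset.mem_range.mpr (hle _ h1 i),
            Finset.mem_range.mpr (hle _ h2 i)⟩, congrFun h3 i⟩
    _ = ∏ i, ∑ y ∈ A i, poissonMass (N / d) y.1 * poissonMass (N / d) y.2 :=
        (Finset.prod_univ_sum A fun (_ : Fin d) (y : ℕ × ℕ) =>
          poissonMass (N / d) y.1 * poissonMass (N / d) y.2).symm
    _ ≤ _ := Finset.prod_le_prod (fun i _ => Finset.sum_nonneg fun y _ =>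
          mul_nonneg (poissonMass_nonneg _ _) (poissonMass_nonneg _ _)) fun i _ =>
        sum_poissonMass_mul_le_walkMass _ _ _ fun y hy => (Finset.mem_filter.mp hy).2

lemma sum_prod_walkMass_le_one {d : ℕ} (r : ℝ≥0) (D : Finset (Fin d → ℤ)) :
    ∑ z ∈ D, ∏ i, walkMass r (z i) ≤ 1 := by
  obtain ⟨E, hE⟩ : ∃ E : Fin d → Finset ℤ, ∀ i, E i = D.image (fun z => z i) := ⟨_, fun _ => rfl⟩
  have hD : D ⊆ Fintype.piFinset E := fun z hz => Fintype.mem_piFinset.mpr fun i => by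
    rw [hE]
    exact Finset.mem_image_of_mem (fun z : Fin d → ℤ => z i) hz
  refine (Finset.sum_le_sum_of_subset_of_nonneg hD fun z _ _ =>
    Finset.prod_nonneg fun i _ => walkMass_nonneg _ _).trans ?_
  rw [← Finset.prod_univ_sum E fun _ x => walkMass r x]
  exact Finset.prod_le_one (fun i _ => Finset.sum_nonneg fun x _ => walkMass_nonneg _ _)
    fun i _ => sum_walkMass_le_one r _

/-- The entropy of the difference of two independent uniform multinomial vectors. -/
noncomputable def multinomialDiffEntropy (d N : ℕ) : ℝ :=
  ∑ z ∈ multinomialDiffSupport d N, Real.negMulLog (multinomialDiffMass N z)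

lemma log_prod_walkMass {d : ℕ} {r : ℝ≥0} (hr : 0 < r) (z : Fin d → ℤ) :
    Real.log (∏ i, walkMass r (z i)) = -∑ i, walkInfo r (z i) := by
  rw [Real.log_prod fun i _ => (walkMass_pos hr _).ne', ← Finset.sum_neg_distrib]
  exact Finset.sum_congr rfl fun i _ => (neg_neg _).symm

/-- Gibbs' inequality, against the law of `d` independent walks. -/
lemma multinomialDiffEntropy_le {d N : ℕ} (hd : d ≠ 0) (hN : N ≠ 0) :
    multinomialDiffEntropy d N ≤ d * binomialCrossEntropy N (N / d) := by
  have hr : (0 : ℝ≥0) < N / d :=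
    div_pos (by exact_mod_cast Nat.pos_of_ne_zero hN) (by exact_mod_cast Nat.pos_of_ne_zero hd)
  have h : ∀ z : Fin d → ℤ, Real.negMulLog (multinomialDiffMass N z)
      ≤ multinomialDiffMass N z * ∑ i, walkInfo (N / d) (z i)
        + (∏ i, walkMass (N / d) (z i) - multinomialDiffMass N z) := fun z => by
    -- `m log (Q / m) ≤ Q - m`
    have hQ : 0 < ∏ i, walkMass (N / d) (z i) := Finset.prod_pos fun i _ => walkMass_pos hr _
    rcases (multinomialDiffMass_nonneg N z).eq_or_lt with h0 | h0
    · rw [← h0]; simpa using hQ.le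
    · have h1 := Real.log_le_sub_one_of_pos (div_pos hQ h0)
      rw [Real.log_div hQ.ne' h0.ne', log_prod_walkMass hr] at h1
      have h2 := mul_le_mul_of_nonneg_left h1 h0.le
      rw [mul_sub (multinomialDiffMass N z) (_ / _), mul_div_cancel₀ _ h0.ne'] at h2
      rw [Real.negMulLog]
      linarith
  refine (Finset.sum_le_sum fun z _ => h z).trans ?_
  rw [Finset.sum_add_distrib, Finset.sum_sub_distrib, sum_multinomialDiffMass hd,
    sum_multinomialDiffMass_mul_walkInfo hN]
  linarith [sum_prod_walkMass_le_one (d := d) (N / d) (multinomialDiffSupport d N)]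

/-- The loss in Gibbs' inequality is at most the information content of the conditioning. -/
lemma le_multinomialDiffEntropy {d N : ℕ} (hd : d ≠ 0) (hN : N ≠ 0) :
    d * binomialCrossEntropy N (N / d) + 2 * Real.log (poissonMass N N)
      ≤ multinomialDiffEntropy d N := by
  have hN0 : (0 : ℝ≥0) < N := by exact_mod_cast Nat.pos_of_ne_zero hN
  have hr : (0 : ℝ≥0) < N / d := div_pos hN0 (by exact_mod_cast Nat.pos_of_ne_zero hd)
  have hpN := poissonMass_pos hN0 N
  have h : ∀ z : Fin d → ℤ, multinomialDiffMass N z * ∑ i, walkInfo (N / d) (z i)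
      + multinomialDiffMass N z * (2 * Real.log (poissonMass N N))
      ≤ Real.negMulLog (multinomialDiffMass N z) := fun z => by
    rcases (multinomialDiffMass_nonneg N z).eq_or_lt with h0 | h0
    · rw [← h0]; simp
    · have h1 := Real.log_le_log (by positivity) (multinomialDiffMass_mul_le (N := N) hd z)
      rw [log_prod_walkMass hr, Real.log_mul h0.ne' (by positivity), Real.log_pow] at h1
      push_cast at h1
      rw [Real.negMulLog, neg_mul, ← mul_neg, ← mul_add]
      exact mul_le_mul_of_nonneg_left (by linarith) h0.le
  refine le_trans (le_of_eq ?_) (Finset.sum_le_sum fun z _ => h z)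
  rw [Finset.sum_add_distrib, ← Finset.sum_mul, sum_multinomialDiffMass hd,
    sum_multinomialDiffMass_mul_walkInfo hN, one_mul]

/-! ### From the law of the difference to the asymptotic estimate -/

lemma lintegral_multinomialLaw {d : ℕ} (N : ℕ) (g : (Fin d → ℤ) → ℝ≥0∞) :
    ∫⁻ x, g x ∂multinomialLaw N (fun _ : Fin d => 1 / (d : ℝ))
      = ∑ x ∈ Finset.piAntidiag Finset.univ N,
          ENNReal.ofReal (uniformMultinomialMass x) * g fun i => x i := by
  rw [multinomialLaw, lintegral_finsetSum_measure]
  refine Finset.sum_congr rfl fun x _ => ?_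
  rw [lintegral_smul_measure, lintegral_dirac]
  rfl

lemma map_sub_real_singleton {d N : ℕ} (hd : d ≠ 0) {Ω : Type*} [MeasurableSpace Ω]
    {P : Measure Ω} [IsProbabilityMeasure P] {X Y : Ω → Fin d → ℤ}
    (hX : HasLaw X (multinomialLaw N fun _ => 1 / (d : ℝ)) P)
    (hY : HasLaw Y (multinomialLaw N fun _ => 1 / (d : ℝ)) P)
    (hXY : IndepFun X Y P) (z : Fin d → ℤ) :
    (P.map (X - Y)).real {z} = multinomialDiffMass N z := by
  set M := multinomialLaw N fun _ : Fin d => 1 / (d : ℝ) with hM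
  have hMp : IsProbabilityMeasure M := isProbabilityMeasure_multinomialLaw N _
    (fun _ => by positivity) (by
      have : (d : ℝ) ≠ 0 := by exact_mod_cast hd
      simp [this])
  have hmap : P.map (X - Y) = (M.prod M).map (fun p => p.1 - p.2) := by
    have h := (indepFun_iff_map_prod_eq_prod_map_map hX.aemeasurable hY.aemeasurable).mp hXY
    rw [hX.map_eq, hY.map_eq] at h
    rw [← h, AEMeasurable.map_map_of_aemeasurable Measurable.of_discrete.aemeasurable
      (hX.aemeasurable.prodMk hY.aemeasurable)]
    rfl
  have hval : P.map (X - Y) {z} = ENNReal.ofReal (multinomialDiffMass N z) := by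
    rw [hmap, ← lintegral_indicator_one (measurableSet_singleton z),
      lintegral_map .of_discrete .of_discrete,
      lintegral_prod _ Measurable.of_discrete.aemeasurable]
    simp_rw [hM, lintegral_multinomialLaw, Finset.mul_sum]
    rw [multinomialDiffMass, ENNReal.ofReal_sum_of_nonneg fun q _ =>
        mul_nonneg (uniformMultinomialMass_nonneg _) (uniformMultinomialMass_nonneg _),
      ← Finset.sum_product', Finset.sum_filter]
    refine Finset.sum_congr rfl fun q _ => ?_
    have hq : ((fun i => (q.1 i : ℤ)) - fun i => (q.2 i : ℤ)) = fun i => (q.1 i : ℤ) - q.2 i := rfl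
    rw [hq, Set.indicator_apply]
    simp only [Set.mem_singleton_iff, Pi.one_apply]
    split_ifs
    · rw [mul_one, ENNReal.ofReal_mul (uniformMultinomialMass_nonneg _)]
    · simp
  rw [measureReal_def, hval, ENNReal.toReal_ofReal (multinomialDiffMass_nonneg N z)]

lemma shannonEntropy_map_sub {d N : ℕ} (hd : d ≠ 0) {Ω : Type*} [MeasurableSpace Ω]
    {P : Measure Ω} [IsProbabilityMeasure P] {X Y : Ω → Fin d → ℤ}
    (hX : HasLaw X (multinomialLaw N fun _ => 1 / (d : ℝ)) P)
    (hY : HasLaw Y (multinomialLaw N fun _ => 1 / (d : ℝ)) P)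
    (hXY : IndepFun X Y P) :
    shannonEntropy (P.map (X - Y)) = multinomialDiffEntropy d N := by
  unfold shannonEntropy multinomialDiffEntropy
  simp_rw [map_sub_real_singleton hd hX hY hXY]
  exact tsum_eq_sum fun z hz => by rw [multinomialDiffMass_of_notMem hz, Real.negMulLog_zero]

lemma multinomialDiffEntropy_le_mul_walkEntropy {d N : ℕ} (hd : d ≠ 0) (hN : N ≠ 0) :
    multinomialDiffEntropy d N ≤ d * walkEntropy (2 * (N / d)) := by
  have hr : (0 : ℝ≥0) < N / d :=
    div_pos (by exact_mod_cast Nat.pos_of_ne_zero hN) (by exact_mod_cast Nat.pos_of_ne_zero hd)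
  have hrN : (N / d : ℝ≥0) ≤ N :=
    div_le_self (by positivity) (by exact_mod_cast Nat.pos_of_ne_zero hd)
  exact (multinomialDiffEntropy_le hd hN).trans
    (mul_le_mul_of_nonneg_left (binomialCrossEntropy_le hN hr hrN) (by positivity))

lemma mul_walkEntropy_sub_multinomialDiffEntropy_le {d N : ℕ} (hd : 2 ≤ d) (hN : N ≠ 0) :
    d * walkEntropy (2 * (N / d)) - multinomialDiffEntropy d N
      ≤ 60 + 8 * (d / N : ℝ) + 10 * Real.log N := by
  have hN0 : (0 : ℝ≥0) < N := by exact_mod_cast Nat.pos_of_ne_zero hN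
  have hN1 : (1 : ℝ) ≤ N := by exact_mod_cast Nat.one_le_iff_ne_zero.mpr hN
  have hd2 : (2 : ℝ) ≤ d := by exact_mod_cast hd
  have hd0 : d ≠ 0 := by omega
  obtain ⟨r, hrdef⟩ : ∃ r : ℝ≥0, r = N / d := ⟨_, rfl⟩
  have hr : 0 < r := by
    rw [hrdef]; exact div_pos hN0 (by exact_mod_cast Nat.pos_of_ne_zero hd0)
  have hr0 : (0 : ℝ) < r := hr
  have hrN : d * (r : ℝ) = N := by
    rw [hrdef]; push_cast; field_simp
  have hrle : r ≤ N := by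
    rw [← NNReal.coe_le_coe]; push_cast; nlinarith
  obtain ⟨s, hrs⟩ : ∃ s : ℝ≥0, r + s = N := ⟨N - r, add_tsub_cancel_of_le hrle⟩
  have hrs' : (r : ℝ) + s = N := by exact_mod_cast hrs
  have hsN : (N : ℝ) / 2 ≤ s := by nlinarith
  have hs0 : (0 : ℝ) < s := by linarith
  have hlogN : 0 ≤ Real.log N := Real.log_nonneg hN1
  have hlog : Real.log (1 + N) ≤ 1 + Real.log N := by
    have h : Real.log (1 + N) ≤ Real.log (2 * N) := Real.log_le_log (by positivity) (by linarith)
    rw [Real.log_mul (by positivity) (by positivity)] at h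
    linarith [Real.log_two_lt_d9]
  have hlogr : Real.log (1 + r) ≤ Real.log (1 + N) :=
    Real.log_le_log (by positivity) (by linarith [NNReal.coe_le_coe.mpr hrle, hrs', s.2])
  have hgauss := le_multinomialDiffEntropy hd0 hN
  have hcross := walkEntropy_sub_binomialCrossEntropy_le hN hr hs0 hrs
  have hpN : -Real.log (poissonMass N N) ≤ Real.log (1 + N) + 1 := by
    simpa using neg_log_poissonMass_le hN0 N
  rw [← hrdef] at hgauss ⊢
  -- as `s ≥ N / 2 = d * r / 2`, the factor `d` cancels
  have hloss : d * ((16 * r + 4 + 4 * (Real.log (1 + r) + 2) * r) / s)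
      ≤ 2 * (16 + 4 * (d / N : ℝ) + 4 * (Real.log N + 3)) := by
    rw [mul_div_assoc', div_le_iff₀ hs0]
    have e : (d : ℝ) * (16 * r + 4 + 4 * (Real.log (1 + r) + 2) * r)
        = (16 + 4 * (d / N : ℝ) + 4 * (Real.log (1 + r) + 2)) * N := by
      rw [← hrN]; field_simp
    rw [e]
    have h1 : (16 + 4 * (d / N : ℝ) + 4 * (Real.log (1 + r) + 2))
        ≤ 16 + 4 * (d / N : ℝ) + 4 * (Real.log N + 3) := by linarith
    have h2 : 0 ≤ 16 + 4 * (d / N : ℝ) + 4 * (Real.log N + 3) := by positivity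
    nlinarith
  have hcross' := mul_le_mul_of_nonneg_left hcross (Nat.cast_nonneg (α := ℝ) d)
  linarith

/-- The entropy of the difference of two multinomial vectors is that of `d` independent walks,
up to an error logarithmic in `N`. -/
lemma isBigO_shannonEntropy_sub_mul_walkEntropy {ι : Type*} {l : Filter ι} {d N : ι → ℕ}
    (hd : Tendsto d l atTop) (hN : Tendsto N l atTop)
    (hdN : (fun i => (d i : ℝ)) =O[l] fun i => (N i : ℝ))
    {Ω : ι → Type*} [∀ i, MeasurableSpace (Ω i)]
    {P : (i : ι) → Measure (Ω i)} [∀ i, IsProbabilityMeasure (P i)]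
    {X Y : (i : ι) → Ω i → (Fin (d i) → ℤ)}
    (hX : ∀ i, HasLaw (X i) (multinomialLaw (N i) fun _ => 1 / (d i : ℝ)) (P i))
    (hY : ∀ i, HasLaw (Y i) (multinomialLaw (N i) fun _ => 1 / (d i : ℝ)) (P i))
    (hXY : ∀ i, IndepFun (X i) (Y i) (P i)) :
    (fun i => shannonEntropy ((P i).map (X i - Y i))
        - (d i : ℝ) * walkEntropy (2 * (N i : ℝ≥0) / (d i : ℝ≥0)))
      =O[l] fun i => Real.log (N i : ℝ) := by
  obtain ⟨C, hC⟩ := hdN.bound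
  refine IsBigO.of_bound (70 + 8 * C) ?_
  filter_upwards [hC, hd.eventually_ge_atTop 2, hN.eventually_ge_atTop 3] with i hCi hdi hNi
  have hd0 : d i ≠ 0 := by omega
  have hN0 : N i ≠ 0 := by omega
  have hN3 : (3 : ℝ) ≤ N i := by exact_mod_cast hNi
  have hlog : 1 ≤ Real.log (N i) := by
    rw [Real.le_log_iff_exp_le (by linarith)]
    linarith [Real.exp_one_lt_d9]
  rw [shannonEntropy_map_sub hd0 (hX i) (hY i) (hXY i), mul_div_assoc]
  have h1 := multinomialDiffEntropy_le_mul_walkEntropy hd0 hN0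
  have h2 := mul_walkEntropy_sub_multinomialDiffEntropy_le hdi hN0
  have h3 : (d i / N i : ℝ) ≤ C := by
    rw [div_le_iff₀ (by linarith)]
    simpa using hCi
  have h4 : (0 : ℝ) ≤ d i / N i := by positivity
  rw [Real.norm_of_nonpos (by linarith), Real.norm_of_nonneg (by linarith)]
  nlinarith

theorem proposition3p3 {ι : Type*} {l : Filter ι} (d N : ι → ℕ)
    (hd : Tendsto d l atTop)
    (hdN : (fun i => (d i : ℝ)) =O[l] fun i => (N i : ℝ))
    {Ω : ι → Type*} [∀ i, MeasurableSpace (Ω i)]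
    (P : (i : ι) → Measure (Ω i)) [∀ i, IsProbabilityMeasure (P i)]
    (X Y : (i : ι) → Ω i → (Fin (d i) → ℤ))
    (hX : ∀ i, HasLaw (X i) (multinomialLaw (N i) fun _ => 1 / (d i : ℝ)) (P i))
    (hY : ∀ i, HasLaw (Y i) (multinomialLaw (N i) fun _ => 1 / (d i : ℝ)) (P i))
    (hXY : ∀ i, IndepFun (X i) (Y i) (P i)) :
    ((fun i => (d i : ℝ)) =o[l] (fun i => (N i : ℝ)) →
      (fun i => shannonEntropy ((P i).map (X i - Y i))
          - (d i : ℝ) * walkEntropy (2 * (N i : ℝ≥0) / (d i : ℝ≥0)))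
        =O[l] fun i =>
          max (max ((d i : ℝ) * (N i : ℝ) ^ (-(1 / 3) : ℝ))
              ((d i : ℝ) * ((N i : ℝ) / (d i : ℝ)) ^ (-(1 / 4) : ℝ)))
            (Real.log (N i : ℝ))) ∧
    ((fun i => (d i : ℝ)) =Θ[l] (fun i => (N i : ℝ)) →
      (fun i => shannonEntropy ((P i).map (X i - Y i))
          - (d i : ℝ) * walkEntropy (2 * (N i : ℝ≥0) / (d i : ℝ≥0)))
        =O[l] fun i => (N i : ℝ) ^ (2 / 3 : ℝ)) := by
  have hN : Tendsto N l atTop := by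
    obtain ⟨C, hC0, hC⟩ := hdN.exists_pos
    refine tendsto_natCast_atTop_iff.mp (tendsto_atTop_mono' l ?_
      ((tendsto_natCast_atTop_iff (R := ℝ)).mpr hd |>.atTop_div_const hC0))
    filter_upwards [hC.bound] with i hi
    rw [div_le_iff₀ hC0, mul_comm]
    simpa using hi
  have key := isBigO_shannonEntropy_sub_mul_walkEntropy hd hN hdN hX hY hXY
  refine ⟨fun _ => key.trans (IsBigO.of_bound' ?_), fun _ => key.trans ?_⟩
  · filter_upwards [hN.eventually_ge_atTop 1] with i hi
    rw [Real.norm_of_nonneg (Real.log_nonneg (by exact_mod_cast hi))]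
    exact (le_max_right _ _).trans (le_abs_self _)
  · exact ((isLittleO_log_rpow_atTop (by norm_num)).comp_tendsto
      (tendsto_natCast_atTop_atTop.comp hN)).isBigO
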